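/- Let $X=(X_t)_{t\in\mathbb Z}$ be a stationary and ergodic process with values in $\mathbb R^d$, defined on a probability space $(\Omega,\mathcal A,\mathbb P)$, with $\mathbb E\log_+|X_0|<\infty$. Let $\alpha\in\mathbb R$, $\gamma\in\mathbb R^d$, let $F:\mathbb R\to[0,1]$ be a cumulative distribution function that is Lipschitz and positive everywhere, and let $g:\mathbb R\to\mathbb R$ satisfy $|g(s)-g(s')|\le\kappa|s-s'|$ for all $s,s'\in\mathbb R$, for some $\kappa\in(0,1)$. Consider processes $Y=(Y_t)_{t\in\mathbb Z}$ with values in $\{0,1\}$ and real processes $\lambda=(\lambda_t)_{t\in\mathbb Z}$ such that, almost surely for every $t\in\mathbb Z$, $$\mathbb P\left(Y_t=1\mid Y_{t-1},Y_{t-2},\ldots;\,X\right)=F(\lambda_t),\qquad \lambda_t=g(\lambda_{t-1})+\alpha Y_{t-1}+\gamma'X_t .\qquad(*)$$ (Existence.) There is a probability measure on $\{0,1\}^{\mathbb Z}\times\Omega$ whose marginal on $\Omega$ is $\mathbb P$ and such that, with $Y_t(y,\omega)=y_t$, $X_t(y,\omega)=X_t(\omega)$ and a suitable process $\lambda$ on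 this space, $(*)$ holds, the process $((X_t,Y_t,\lambda_t))_{t\in\mathbb Z}$ is stationary, and the process $((X_t,Y_t))_{t\in\mathbb Z}$ is stationary and ergodic. (Uniqueness.) If $(X',Y',\lambda')$ is defined on any probability space and satisfies $(*)$, if $X'$ has the same law as $X$, and if $((X'_t,Y'_t))_{t\in\mathbb Z}$ is stationary or $(\lambda'_t)_{t\in\mathbb Z}$ is stationary, then $((X'_t,Y'_t))_{t\in\mathbb Z}$ has the same law as $((X_t,Y_t))_{t\in\mathbb Z}$ above. -/

import Mathlib

open MeasureTheory ProbabilityTheory Filter Topology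

namespace BinaryAR

/-- The left shift on two-sided sequences: `(x_t)_{t ∈ ℤ} ↦ (x_{t+1})_{t ∈ ℤ}`. -/
def shift {S : Type*} (x : ℤ → S) : ℤ → S := fun t => x (t + 1)

/-- The law of a two-sided process on the path space `S^ℤ` (with its product σ-algebra). -/
noncomputable def pathLaw {Ω S : Type*} [MeasurableSpace Ω] [MeasurableSpace S]
    (Z : ℤ → Ω → S) (P : Measure Ω) : Measure (ℤ → S) :=
  P.map (fun ω t => Z t ω)

/-- A two-sided process is (strictly) stationary: its law is invariant under the shift. -/
structure IsStationary {Ω S : Type*} [MeasurableSpace Ω] [MeasurableSpace S]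
    (Z : ℤ → Ω → S) (P : Measure Ω) : Prop where
  measurable : ∀ t, Measurable (Z t)
  invariant : MeasurePreserving shift (pathLaw Z P) (pathLaw Z P)

/-- A two-sided process is stationary and ergodic: its law is invariant under the shift, and
every shift-invariant event has probability zero or one. -/
structure IsStationaryErgodic {Ω S : Type*} [MeasurableSpace Ω] [MeasurableSpace S]
    (Z : ℤ → Ω → S) (P : Measure Ω) : Prop where
  measurable : ∀ t, Measurable (Z t)
  ergodic : Ergodic shift (pathLaw Z P)

/-- `F` is the cumulative distribution function of a probability measure on `ℝ`. -/
def IsCDF (F : ℝ → ℝ) : Prop :=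
  ∃ ν : Measure ℝ, IsProbabilityMeasure ν ∧ ∀ s, F s = cdf ν s

/-- The σ-algebra generated by `Y_{t-1}, Y_{t-2}, …` and by the whole process `X`. -/
abbrev info {Ω S : Type*} [MeasurableSpace S] (X : ℤ → Ω → S) (Y : ℤ → Ω → Fin 2) (t : ℤ) :
    MeasurableSpace Ω :=
  (⨆ s : {s : ℤ // s < t}, MeasurableSpace.comap (Y s) inferInstance) ⊔
    ⨆ s : ℤ, MeasurableSpace.comap (X s) inferInstance

/-- The processes `X` (covariate), `Y` (binary response) and `lam` (latent), defined on the
probability space `(Ω, P)`, satisfy the binary model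
`P(Y_t = 1 | Y_{t-1}, Y_{t-2}, …, X) = F(lam_t)`,
`lam_t = g(lam_{t-1}) + α Y_{t-1} + γ' X_t`, for all `t ∈ ℤ`, almost surely. -/
structure IsSolution {d : ℕ} (F g : ℝ → ℝ) (α : ℝ) (γ : EuclideanSpace ℝ (Fin d))
    {Ω : Type*} [MeasurableSpace Ω] (P : Measure Ω)
    (X : ℤ → Ω → EuclideanSpace ℝ (Fin d)) (Y : ℤ → Ω → Fin 2) (lam : ℤ → Ω → ℝ) : Prop where
  measurable_X : ∀ t, Measurable (X t)
  measurable_Y : ∀ t, Measurable (Y t)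
  measurable_lam : ∀ t, Measurable (lam t)
  cond_prob : ∀ t, P[(Y t ⁻¹' {1}).indicator (fun _ => (1 : ℝ)) | info X Y t]
    =ᵐ[P] fun ω => F (lam t ω)
  recursion : ∀ t, ∀ᵐ ω ∂P,
    lam t ω = g (lam (t - 1) ω) + α * ((Y (t - 1) ω : ℕ) : ℝ) + inner ℝ γ (X t ω)

end BinaryAR

/-! Conditionally on the covariates, the responses form a chain with infinite memory. Since `g`
contracts, the latent process started in the remote past is a function `latent` of the covariates
and of earlier responses, and its dependence on responses `n` steps back decays like `κ ^ n`. The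
model then says that the joint law of the trajectories is `IsGibbs` for the specification
`response`: each response, given the environment and the past, is `1` with a prescribed probability.
`iterTransfer` computes the conditional expectation of a function of finitely many responses given
the environment and the responses before an earlier time.

Everything rests on `Forgets`: for almost every environment these conditional expectations lose
their dependence on the remote past (`forgets_of_recurrent`). Couple two pasts. By Poincaré
recurrence there are arbitrarily early times `s` at which the latent process is bounded uniformly in
the responses. During the next `N` steps the two chains can be made to agree with probability at
least `c ^ N`, because `F` is bounded below on bounded sets. Their conditional probabilities then
differ by geometrically small amounts, so the chance of a later separation is at most `1 / 2`. Each
such attempt shrinks the oscillation by a fixed factor. The logarithmic moment makes the discounted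
sums of the covariates finite.

Forgetting gives uniqueness of a Gibbs law with given environment marginal
(`IsGibbs.eq_of_map_fst_eq`). For existence, compactness of `{0,1}^ℤ` provides a law for each fixed
environment, and forgetting makes it measurable in the environment (`exists_kernel_isGibbs`).
Uniqueness also gives shift invariance, and ergodicity: a Gibbs law restricted to an invariant event
is still Gibbs, and its marginal is a multiple of the ergodic marginal, so the restriction is a
multiple of the whole law.

It remains to show that a solution has a Gibbs law although its `λ` need not be the one started in
the remote past. The distance between the two contracts forward in time. If `λ` is stationary,
looking back `n` steps shows that it vanishes. If `(X, Y)` is stationary, the defect in the Gibbs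
identity is the same at all times and tends to zero. -/

namespace BinaryAR

/-! ### Transfer operators, and uniqueness of the Gibbs law under forgetting -/

/-- Average of `h` when the coordinate at time `s` is resampled, being `1` with probability `q`. -/
def transfer (q : (ℤ → Fin 2) → ℝ) (s : ℤ) (h : (ℤ → Fin 2) → ℝ) (y : ℤ → Fin 2) : ℝ :=
  q y * h (Function.update y s 1) + (1 - q y) * h (Function.update y s 0)

/-- Resampling of the coordinates at times `t - n, …, t - 1`, in this order. -/
def iterTransfer (q : ℤ → (ℤ → Fin 2) → ℝ) (t : ℤ) (h : (ℤ → Fin 2) → ℝ) :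
    ℕ → (ℤ → Fin 2) → ℝ
  | 0 => h
  | n + 1 => transfer (q (t - (n + 1 : ℕ))) (t - (n + 1 : ℕ)) (iterTransfer q t h n)

/-- The random binary sequence with joint law `ρ` with the environment has, given the environment
and its past at time `s`, probability `p x s y` to be `1` at time `s`. -/
def IsGibbs {S : Type*} [MeasurableSpace S] (p : S → ℤ → (ℤ → Fin 2) → ℝ)
    (ρ : Measure (S × (ℤ → Fin 2))) : Prop :=
  ∀ (s : ℤ) (f : S → (ℤ → Fin 2) → ℝ), Measurable (Function.uncurry f) →
    (∃ C, ∀ x y, |f x y| ≤ C) → (∀ x, DependsOn (f x) (Set.Iic s)) →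
    ∫ z, f z.1 z.2 ∂ρ = ∫ z, transfer (p z.1 s) s (f z.1) z.2 ∂ρ

/-- The initial condition in the remote past is forgotten. -/
def Forgets (q : ℤ → (ℤ → Fin 2) → ℝ) : Prop :=
  ∀ (a t : ℤ) (h : (ℤ → Fin 2) → ℝ), (∀ y, |h y| ≤ 1) → DependsOn h (Set.Ico a t) →
    ∀ ε > 0, ∃ n, ∀ y y', |iterTransfer q t h n y - iterTransfer q t h n y'| ≤ ε

/-- A family of conditional probabilities that depend measurably on the environment and the
past. -/
structure IsSpecification {S : Type*} [MeasurableSpace S] (p : S → ℤ → (ℤ → Fin 2) → ℝ) :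
    Prop where
  mem_Icc : ∀ x s y, p x s y ∈ Set.Icc (0 : ℝ) 1
  measurable : ∀ s, Measurable (fun z : S × (ℤ → Fin 2) => p z.1 s z.2)
  dependsOn : ∀ x s, DependsOn (p x s) (Set.Iio s)

section transfer

variable {q : (ℤ → Fin 2) → ℝ} {s : ℤ} {h : (ℤ → Fin 2) → ℝ}

lemma abs_transfer_le (hq : ∀ y, q y ∈ Set.Icc (0 : ℝ) 1) {C : ℝ} (hh : ∀ y, |h y| ≤ C)
    (y : ℤ → Fin 2) : |transfer q s h y| ≤ C := by
  obtain ⟨h0, h1⟩ := hq y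
  have a := abs_le.1 (hh (Function.update y s 1))
  have b := abs_le.1 (hh (Function.update y s 0))
  unfold transfer
  rw [abs_le]
  constructor <;> nlinarith

lemma DependsOn_transfer (hq : DependsOn q (Set.Iio s)) (hh : DependsOn h (Set.Iic s)) :
    DependsOn (transfer q s h) (Set.Iio s) := by
  intro y y' hy
  have key : ∀ a : Fin 2, h (Function.update y s a) = h (Function.update y' s a) := by
    intro a
    apply hh
    intro i hi
    rcases eq_or_ne i s with rfl | hne
    · simp
    · simpa [hne] using hy i (lt_of_le_of_ne hi hne)
  simp only [transfer, hq hy, key]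

lemma transfer_eq_self (hh : DependsOn h (Set.Iio s)) : transfer q s h = h := by
  have key : ∀ y (a : Fin 2), h (Function.update y s a) = h y := by
    intro y a
    apply hh
    intro i hi
    simp [(ne_of_lt hi : i ≠ s)]
  funext y
  simp only [transfer, key]
  ring

/-- Functions of the strict past pull out, like known factors out of a conditional expectation. -/
lemma transfer_mul_left {u : (ℤ → Fin 2) → ℝ} (hu : DependsOn u (Set.Iio s)) :
    transfer q s (fun y => u y * h y) = fun y => u y * transfer q s h y := by
  have key : ∀ y (a : Fin 2), u (Function.update y s a) = u y := by
    intro y a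
    apply hu
    intro i hi
    simp [(ne_of_lt hi : i ≠ s)]
  funext y
  simp only [transfer, key]
  ring

lemma continuous_transfer (hq : Continuous q) (hh : Continuous h) :
    Continuous (transfer q s h) := by
  have : ∀ a : Fin 2, Continuous (fun y : ℤ → Fin 2 => Function.update y s a) :=
    fun a => continuous_id.update s continuous_const
  exact (hq.mul (hh.comp (this 1))).add ((continuous_const.sub hq).mul (hh.comp (this 0)))

end transfer

section iterTransfer

variable {q : ℤ → (ℤ → Fin 2) → ℝ} {t : ℤ} {h : (ℤ → Fin 2) → ℝ}

lemma abs_iterTransfer_le (hq : ∀ s y, q s y ∈ Set.Icc (0 : ℝ) 1) {C : ℝ} (hh : ∀ y, |h y| ≤ C)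
    (n : ℕ) (y : ℤ → Fin 2) : |iterTransfer q t h n y| ≤ C := by
  induction n generalizing y with
  | zero => exact hh y
  | succ n ih => exact abs_transfer_le (hq _) ih y

lemma dependsOn_iterTransfer (hq : ∀ s, DependsOn (q s) (Set.Iio s))
    (hh : DependsOn h (Set.Iio t)) (n : ℕ) :
    DependsOn (iterTransfer q t h n) (Set.Iio (t - n)) := by
  induction n with
  | zero => simpa [iterTransfer] using hh
  | succ n ih =>
    refine DependsOn_transfer (hq _) (ih.mono fun i hi => ?_)
    simp only [Set.mem_Iio, Set.mem_Iic] at hi ⊢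
    push_cast
    omega

lemma iterTransfer_add (m j : ℕ) :
    iterTransfer q t h (m + j) = iterTransfer q (t - m) (iterTransfer q t h m) j := by
  induction j with
  | zero => rfl
  | succ j ih =>
    have : t - ((m + j + 1 : ℕ) : ℤ) = t - m - ((j + 1 : ℕ) : ℤ) := by push_cast; ring
    rw [← add_assoc]
    simp only [iterTransfer, this, ih]

lemma iterTransfer_eq_self (hh : DependsOn h (Set.Iio t)) (m : ℕ) :
    iterTransfer q (t + m) h m = h := by
  have : ∀ j : ℕ, j ≤ m → iterTransfer q (t + m) h j = h := by
    intro j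
    induction j with
    | zero => intro _; rfl
    | succ j ih =>
      intro hj
      rw [iterTransfer, ih (by omega)]
      refine transfer_eq_self (hh.mono fun i hi => ?_)
      simp only [Set.mem_Iio] at hi ⊢
      push_cast
      omega
  exact this m le_rfl

/-- Resampling coordinates on which `h` does not depend has no effect, so the later horizon only
wastes `m` steps. -/
lemma iterTransfer_shift_time (hh : DependsOn h (Set.Iio t)) (m j : ℕ) :
    iterTransfer q (t + m) h (m + j) = iterTransfer q t h j := by
  rw [iterTransfer_add, iterTransfer_eq_self hh]
  congr 1
  ring

/-- Averaging cannot increase the oscillation. -/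
lemma osc_iterTransfer_le (hq : ∀ s y, q s y ∈ Set.Icc (0 : ℝ) 1) {o : ℝ}
    (hh : ∀ y y', |h y - h y'| ≤ o) (n : ℕ) (y y' : ℤ → Fin 2) :
    |iterTransfer q t h n y - iterTransfer q t h n y'| ≤ o := by
  induction n generalizing y y' with
  | zero => exact hh y y'
  | succ n ih =>
    obtain ⟨a0, a1⟩ := hq (t - (n + 1 : ℕ)) y
    obtain ⟨b0, b1⟩ := hq (t - (n + 1 : ℕ)) y'
    simp only [iterTransfer, transfer]
    set s := t - ((n + 1 : ℕ) : ℤ)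
    set u := iterTransfer q t h n
    set a := q s y
    set b := q s y'
    have h11 := abs_le.1 (ih (Function.update y s 1) (Function.update y' s 1))
    have h10 := abs_le.1 (ih (Function.update y s 1) (Function.update y' s 0))
    have h01 := abs_le.1 (ih (Function.update y s 0) (Function.update y' s 1))
    have h00 := abs_le.1 (ih (Function.update y s 0) (Function.update y' s 0))
    -- Independent draws for the two sequences: the difference is an average with product weights.
    have e : ∀ u1 u0 v1 v0 : ℝ, a * u1 + (1 - a) * u0 - (b * v1 + (1 - b) * v0)
        = a * b * (u1 - v1) + a * (1 - b) * (u1 - v0) + (1 - a) * b * (u0 - v1)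
          + (1 - a) * (1 - b) * (u0 - v0) := by intros; ring
    rw [e, abs_le]
    have w11 : 0 ≤ a * b := mul_nonneg a0 b0
    have w10 : 0 ≤ a * (1 - b) := mul_nonneg a0 (by linarith)
    have w01 : 0 ≤ (1 - a) * b := mul_nonneg (by linarith) b0
    have w00 : 0 ≤ (1 - a) * (1 - b) := mul_nonneg (by linarith) (by linarith)
    constructor
    · nlinarith [mul_le_mul_of_nonneg_left h11.1 w11, mul_le_mul_of_nonneg_left h10.1 w10,
        mul_le_mul_of_nonneg_left h01.1 w01, mul_le_mul_of_nonneg_left h00.1 w00]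
    · nlinarith [mul_le_mul_of_nonneg_left h11.2 w11, mul_le_mul_of_nonneg_left h10.2 w10,
        mul_le_mul_of_nonneg_left h01.2 w01, mul_le_mul_of_nonneg_left h00.2 w00]

end iterTransfer

lemma Forgets.eventually {q : ℤ → (ℤ → Fin 2) → ℝ} (H : Forgets q)
    (hq : ∀ s y, q s y ∈ Set.Icc (0 : ℝ) 1)
    {a t : ℤ} {h : (ℤ → Fin 2) → ℝ} (hh : ∀ y, |h y| ≤ 1) (hd : DependsOn h (Set.Ico a t))
    {ε : ℝ} (hε : 0 < ε) :
    ∀ᶠ n in atTop, ∀ y y', |iterTransfer q t h n y - iterTransfer q t h n y'| ≤ ε := by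
  obtain ⟨n, hn⟩ := H a t h hh hd ε hε
  filter_upwards [eventually_ge_atTop n] with m hm y y'
  obtain ⟨j, rfl⟩ := Nat.exists_eq_add_of_le hm
  rw [iterTransfer_add]
  exact osc_iterTransfer_le hq hn j y y'

section Gibbs

variable {S : Type*} [MeasurableSpace S] {p : S → ℤ → (ℤ → Fin 2) → ℝ}

lemma measurable_transfer {s : ℤ} {q : S → (ℤ → Fin 2) → ℝ} {f : S → (ℤ → Fin 2) → ℝ}
    (hq : Measurable (fun z : S × (ℤ → Fin 2) => q z.1 z.2))
    (hf : Measurable (fun z : S × (ℤ → Fin 2) => f z.1 z.2)) :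
    Measurable (fun z : S × (ℤ → Fin 2) => transfer (q z.1) s (f z.1) z.2) := by
  have key : ∀ a : Fin 2, Measurable
      (fun z : S × (ℤ → Fin 2) => f z.1 (Function.update z.2 s a)) := by
    intro a
    have : Measurable (fun z : S × (ℤ → Fin 2) => (z.1, Function.update z.2 s a)) := by
      refine measurable_fst.prodMk (measurable_pi_lambda _ fun i => ?_)
      rcases eq_or_ne i s with rfl | hne
      · simp
      · simp only [ne_eq, hne, not_false_eq_true, Function.update_of_ne]
        exact (measurable_pi_apply i).comp measurable_snd
    exact hf.comp this
  exact (hq.mul (key 1)).add ((measurable_const.sub hq).mul (key 0))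

lemma IsSpecification.measurable_iterTransfer (hp : IsSpecification p) (t : ℤ)
    {f : S → (ℤ → Fin 2) → ℝ} (hf : Measurable (fun z : S × (ℤ → Fin 2) => f z.1 z.2)) (n : ℕ) :
    Measurable (fun z : S × (ℤ → Fin 2) => iterTransfer (p z.1) t (f z.1) n z.2) := by
  induction n with
  | zero => exact hf
  | succ n ih =>
    exact measurable_transfer (f := fun x => iterTransfer (p x) t (f x) n)
      (q := fun x => p x _) (hp.measurable _) ih

/-- Integrals over `S × {0,1}^ℤ` of a bounded function of the binary sequence, on an event of the
environment, are integrals of its iterated transfers. -/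
lemma IsGibbs.integral_iterTransfer {ρ : Measure (S × (ℤ → Fin 2))} (hR : IsGibbs p ρ)
    (hp : IsSpecification p) {B : Set S} (hB : MeasurableSet B) {t : ℤ} {h : (ℤ → Fin 2) → ℝ}
    (hm : Measurable h) {C : ℝ} (hh : ∀ y, |h y| ≤ C) (hd : DependsOn h (Set.Iio t)) (n : ℕ) :
    ∫ z, B.indicator 1 z.1 * h z.2 ∂ρ
      = ∫ z, B.indicator 1 z.1 * iterTransfer (p z.1) t h n z.2 ∂ρ := by
  induction n with
  | zero => rfl
  | succ n ih =>
    rw [ih, hR (t - (n + 1 : ℕ)) (fun x y => B.indicator 1 x * iterTransfer (p x) t h n y)]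
    · refine integral_congr_ae (.of_forall fun z => ?_)
      have := transfer_mul_left (q := p z.1 (t - (n + 1 : ℕ))) (s := t - (n + 1 : ℕ))
        (h := iterTransfer (p z.1) t h n) (u := fun _ => B.indicator (1 : S → ℝ) z.1)
        (fun _ _ _ => rfl)
      exact congrFun this z.2
    · exact ((measurable_one.indicator hB).comp measurable_fst).mul
        (hp.measurable_iterTransfer t (f := fun _ => h) (hm.comp measurable_snd) n)
    · refine ⟨C, fun x y => ?_⟩
      have h0 := abs_iterTransfer_le (t := t) (hp.mem_Icc x) hh n y
      by_cases hx : x ∈ B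
      · simpa [hx] using h0
      · simpa [hx] using (abs_nonneg _).trans h0
    · intro x y y' hy
      simp only
      congr 1
      refine dependsOn_iterTransfer (hp.dependsOn x) hd n fun i hi => hy i ?_
      simp only [Set.mem_Iio, Set.mem_Iic] at hi ⊢
      push_cast
      omega

/-- For large `n` the iterated transfer hardly depends on the binary sequence, which may be replaced
by `0`. The integrals that remain involve only the environment marginal, so the limit is determined
by that marginal. -/
lemma IsGibbs.tendsto_integral {ρ : Measure (S × (ℤ → Fin 2))} [IsFiniteMeasure ρ]
    (hR : IsGibbs p ρ) (hp : IsSpecification p) (hF : ∀ᵐ x ∂(ρ.map Prod.fst), Forgets (p x))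
    {B : Set S} (hB : MeasurableSet B) {a t : ℤ} {h : (ℤ → Fin 2) → ℝ}
    (hm : Measurable h) (hh : ∀ y, |h y| ≤ 1) (hd : DependsOn h (Set.Ico a t)) :
    Tendsto (fun n => ∫ x, B.indicator 1 x * iterTransfer (p x) t h n 0 ∂(ρ.map Prod.fst)) atTop
      (𝓝 (∫ z, B.indicator 1 z.1 * h z.2 ∂ρ)) := by
  have hm1 : Measurable (B.indicator (1 : S → ℝ)) := measurable_one.indicator hB
  have hmI : ∀ n, Measurable fun z : S × (ℤ → Fin 2) => iterTransfer (p z.1) t h n z.2 :=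
    hp.measurable_iterTransfer t (f := fun _ => h) (hm.comp measurable_snd)
  have hmI0 : ∀ n, Measurable fun x : S => iterTransfer (p x) t h n 0 := fun n =>
    (hmI n).comp (measurable_id.prodMk measurable_const)
  have hBb : ∀ x, |B.indicator (1 : S → ℝ) x| ≤ 1 := fun x => by
    by_cases hx : x ∈ B <;> simp [hx]
  have bound : ∀ (x : S) (v : ℝ), |v| ≤ 2 → ‖B.indicator (1 : S → ℝ) x * v‖ ≤ 2 := by
    intro x v hv
    rw [Real.norm_eq_abs, abs_mul]
    nlinarith [hBb x, abs_nonneg v, abs_nonneg (B.indicator (1 : S → ℝ) x)]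
  have e1 : ∀ n, ∫ x, B.indicator 1 x * iterTransfer (p x) t h n 0 ∂(ρ.map Prod.fst)
      = ∫ z, B.indicator 1 z.1 * iterTransfer (p z.1) t h n 0 ∂ρ := fun n =>
    integral_map measurable_fst.aemeasurable (hm1.mul (hmI0 n)).aestronglyMeasurable
  have hle : ∀ x n y, |iterTransfer (p x) t h n y| ≤ 1 := fun x n y =>
    abs_iterTransfer_le (hp.mem_Icc x) hh n y
  have key : Tendsto (fun n => ∫ z, B.indicator 1 z.1 *
      (iterTransfer (p z.1) t h n 0 - iterTransfer (p z.1) t h n z.2) ∂ρ) atTop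
      (𝓝 (∫ z : S × (ℤ → Fin 2), (0 : ℝ) ∂ρ)) := by
    refine tendsto_integral_of_dominated_convergence (fun _ => 2) (fun n => ?_)
      (integrable_const _) (fun n => .of_forall fun z => ?_) ?_
    · exact ((hm1.comp measurable_fst).mul
        (((hmI0 n).comp measurable_fst).sub (hmI n))).aestronglyMeasurable
    · refine bound _ _ ?_
      have := abs_sub (iterTransfer (p z.1) t h n 0) (iterTransfer (p z.1) t h n z.2)
      linarith [hle z.1 n 0, hle z.1 n z.2]
    · filter_upwards [ae_of_ae_map measurable_fst.aemeasurable hF] with z hz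
      rw [Metric.tendsto_nhds]
      intro ε hε
      filter_upwards [hz.eventually (hp.mem_Icc z.1) hh hd (half_pos hε)] with n hn
      rw [Real.dist_eq, sub_zero, abs_mul]
      have := hn 0 z.2
      nlinarith [hBb z.1, abs_nonneg (B.indicator (1 : S → ℝ) z.1),
        abs_nonneg (iterTransfer (p z.1) t h n 0 - iterTransfer (p z.1) t h n z.2)]
  rw [integral_zero] at key
  have e2 : ∀ n, ∫ x, B.indicator 1 x * iterTransfer (p x) t h n 0 ∂(ρ.map Prod.fst)
      = ∫ z, B.indicator 1 z.1 *
          (iterTransfer (p z.1) t h n 0 - iterTransfer (p z.1) t h n z.2) ∂ρ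
        + ∫ z, B.indicator 1 z.1 * h z.2 ∂ρ := by
    intro n
    have hi : ∀ v : S × (ℤ → Fin 2) → ℝ, Measurable v → (∀ z, |v z| ≤ 2) →
        Integrable (fun z => B.indicator 1 z.1 * v z) ρ := fun v hv hv2 =>
      Integrable.of_bound ((hm1.comp measurable_fst).mul hv).aestronglyMeasurable 2
        (.of_forall fun z => bound _ _ (hv2 z))
    rw [e1, hR.integral_iterTransfer hp hB hm hh (hd.mono fun i hi => hi.2) n, ← integral_add]
    · congr 1
      ext z
      ring
    · refine hi _ (((hmI0 n).comp measurable_fst).sub (hmI n)) fun z => ?_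
      have := abs_sub (iterTransfer (p z.1) t h n 0) (iterTransfer (p z.1) t h n z.2)
      linarith [hle z.1 n 0, hle z.1 n z.2]
    · exact hi _ (hmI n) fun z => (hle _ _ _).trans one_le_two
  simp only [e2]
  simpa using key.add_const _

lemma exists_dependsOn_Ico_of_mem_cylinders {C : Set (ℤ → Fin 2)}
    (hC : C ∈ measurableCylinders fun _ : ℤ => Fin 2) :
    ∃ a t : ℤ, DependsOn (C.indicator (1 : (ℤ → Fin 2) → ℝ)) (Set.Ico a t) := by
  obtain ⟨I, T, -, rfl⟩ := (mem_measurableCylinders _).1 hC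
  obtain ⟨a, ha⟩ := I.bddBelow
  obtain ⟨b, hb⟩ := I.bddAbove
  refine ⟨a, b + 1, fun y y' hy => ?_⟩
  have : I.restrict y = I.restrict y' := by
    funext i
    exact hy i ⟨ha i.2, Int.lt_add_one_of_le (hb i.2)⟩
  have e : y ∈ cylinder I T ↔ y' ∈ cylinder I T := by
    simp only [mem_cylinder, this]
  by_cases hm : y ∈ cylinder I T
  · rw [Set.indicator_of_mem hm, Set.indicator_of_mem (e.1 hm), Pi.one_apply, Pi.one_apply]
  · rw [Set.indicator_of_notMem hm, Set.indicator_of_notMem fun h => hm (e.2 h)]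

/-- Uniqueness of the joint law of the environment and the binary sequence. -/
theorem IsGibbs.eq_of_map_fst_eq {ρ ρ' : Measure (S × (ℤ → Fin 2))} [IsFiniteMeasure ρ]
    [IsFiniteMeasure ρ'] (hp : IsSpecification p) (hR : IsGibbs p ρ) (hR' : IsGibbs p ρ')
    (hF : ∀ᵐ x ∂(ρ.map Prod.fst), Forgets (p x)) (h : ρ'.map Prod.fst = ρ.map Prod.fst) :
    ρ' = ρ := by
  refine Measure.ext_prod fun {B A} hB hA => ?_
  have hfin : ∀ ρ : Measure (S × (ℤ → Fin 2)), IsFiniteMeasure ρ →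
      IsFiniteMeasure ((ρ.restrict (B ×ˢ Set.univ)).map Prod.snd) := fun ρ _ => inferInstance
  -- For fixed `B`, the map `C ↦ ρ (B ×ˢ C)` is a finite measure, determined by its values on
  -- cylinders.
  have hap : ∀ (ρ : Measure (S × (ℤ → Fin 2))) {C : Set (ℤ → Fin 2)}, MeasurableSet C →
      ((ρ.restrict (B ×ˢ Set.univ)).map Prod.snd) C = ρ (B ×ˢ C) := by
    intro ρ C hC
    rw [Measure.map_apply measurable_snd hC, Measure.restrict_apply (measurable_snd hC)]
    congr 1
    ext z
    simp [and_comm]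
  have main : ∀ C ∈ measurableCylinders (fun _ : ℤ => Fin 2), ρ' (B ×ˢ C) = ρ (B ×ˢ C) := by
    intro C hC
    have hCm : MeasurableSet C := MeasurableSet.of_mem_measurableCylinders hC
    obtain ⟨a, t, hd⟩ := exists_dependsOn_Ico_of_mem_cylinders hC
    have hm : Measurable (C.indicator (1 : (ℤ → Fin 2) → ℝ)) := measurable_one.indicator hCm
    have hb : ∀ y, |C.indicator (1 : (ℤ → Fin 2) → ℝ) y| ≤ 1 := fun y => by
      by_cases hy : y ∈ C <;> simp [hy]
    have l := hR.tendsto_integral hp hF hB hm hb hd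
    have l' := hR'.tendsto_integral hp (by rwa [h]) hB hm hb hd
    rw [h] at l'
    have e := tendsto_nhds_unique l' l
    have hin : ∀ ρ : Measure (S × (ℤ → Fin 2)),
        ∫ z, B.indicator (1 : S → ℝ) z.1 * C.indicator (1 : (ℤ → Fin 2) → ℝ) z.2 ∂ρ
          = ρ.real (B ×ˢ C) := by
      intro ρ
      rw [← integral_indicator_one (hB.prod hCm)]
      congr 1
      ext z
      by_cases h1 : z.1 ∈ B <;> by_cases h2 : z.2 ∈ C <;> simp [Set.indicator, h1, h2]
    rw [hin, hin] at e
    exact (measureReal_eq_measureReal_iff).1 e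
  rw [← hap ρ' hA, ← hap ρ hA]
  congr 1
  have := hfin ρ inferInstance
  have := hfin ρ' inferInstance
  refine ext_of_generate_finite _ (generateFrom_measurableCylinders (α := fun _ : ℤ => Fin 2)).symm
    isPiSystem_measurableCylinders (fun C hC => ?_) ?_
  · rw [hap ρ' (MeasurableSet.of_mem_measurableCylinders hC),
      hap ρ (MeasurableSet.of_mem_measurableCylinders hC), main C hC]
  · rw [hap ρ' .univ, hap ρ .univ]
    exact main _ (univ_mem_measurableCylinders _)

end Gibbs

end BinaryAR

/-! ### Existence of a Gibbs law by compactness -/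

namespace BinaryAR

/-- The sequence `y` with the coordinates from time `t` on replaced by zero. -/
def past (t : ℤ) (y : ℤ → Fin 2) : ℤ → Fin 2 := fun s => if s < t then y s else 0

lemma past_apply_of_lt {t s : ℤ} (h : s < t) (y : ℤ → Fin 2) : past t y s = y s := if_pos h

lemma dependsOn_past (t : ℤ) : DependsOn (past t) (Set.Iio t) := by
  intro y y' hy
  funext s
  by_cases hs : s < t
  · simp [past, hs, hy s hs]
  · simp [past, hs]

lemma DependsOn.comp_past {β : Type*} {t : ℤ} {f : (ℤ → Fin 2) → β}
    (hf : DependsOn f (Set.Iio t)) (y : ℤ → Fin 2) : f (past t y) = f y :=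
  hf fun _ hs => past_apply_of_lt hs y

lemma continuous_past (t : ℤ) : Continuous (past t) := by
  refine continuous_pi fun s => ?_
  by_cases hs : s < t
  · simpa [past, hs] using continuous_apply s
  · simpa [past, hs] using continuous_const

lemma measurable_past (t : ℤ) : Measurable (past t) := by
  refine measurable_pi_lambda _ fun s => ?_
  by_cases hs : s < t
  · simpa [past, hs] using measurable_pi_apply s
  · simp [past, hs]

/-- The event that the coordinate at time `s` is `1`, as a real function. -/
noncomputable def isOne (s : ℤ) (y : ℤ → Fin 2) : ℝ := ((y s : ℕ) : ℝ)

lemma isOne_eq_indicator (s : ℤ) :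
    isOne s = {y : ℤ → Fin 2 | y s = 1}.indicator (1 : (ℤ → Fin 2) → ℝ) := by
  funext y
  by_cases h : y s = 1
  · simp [isOne, h]
  · have : y s = 0 := by omega
    simp [isOne, this]

lemma isOne_mem_Icc (s : ℤ) (y : ℤ → Fin 2) : isOne s y ∈ Set.Icc (0 : ℝ) 1 := by
  rw [isOne_eq_indicator]
  by_cases h : y ∈ {y : ℤ → Fin 2 | y s = 1} <;> simp [h]

lemma continuous_isOne (s : ℤ) : Continuous (isOne s) :=
  (continuous_of_discreteTopology (f := fun a : Fin 2 => ((a : ℕ) : ℝ))).comp (continuous_apply s)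

lemma measurable_isOne (s : ℤ) : Measurable (isOne s) := (continuous_isOne s).measurable

lemma transfer_isOne_mul {q : (ℤ → Fin 2) → ℝ} {s : ℤ} {h : (ℤ → Fin 2) → ℝ}
    (hh : DependsOn h (Set.Iio s)) :
    transfer q s (fun y => h y * isOne s y) = fun y => h y * q y := by
  rw [transfer_mul_left hh]
  funext y
  simp [transfer, isOne]

lemma integrable_of_continuous {μ : Measure (ℤ → Fin 2)} [IsFiniteMeasure μ]
    {f : (ℤ → Fin 2) → ℝ} (hf : Continuous f) : Integrable f μ :=
  (BoundedContinuousFunction.mkOfCompact ⟨f, hf⟩).integrable μ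

section Fiber

variable {q : ℤ → (ℤ → Fin 2) → ℝ}

/-- This is the law of the chain started from `y` and run over the times `t - n, …, t - 1`: a
mixture, with weights `q` and `1 - q`, of the laws started from the two updates of `y`. -/
lemma exists_measure_integral_eq_iterTransfer (hq : ∀ s y, q s y ∈ Set.Icc (0 : ℝ) 1) (t : ℤ)
    (n : ℕ) (y : ℤ → Fin 2) : ∃ μ : Measure (ℤ → Fin 2), IsProbabilityMeasure μ ∧
      ∀ f : (ℤ → Fin 2) → ℝ, Continuous f → ∫ z, f z ∂μ = iterTransfer q t f n y := by
  induction n generalizing y with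
  | zero =>
    exact ⟨Measure.dirac y, inferInstance, fun f hf => by simp [iterTransfer]⟩
  | succ n ih =>
    set s : ℤ := t - (n + 1 : ℕ) with hs
    obtain ⟨μ, hμ, hμi⟩ := ih (Function.update y s 1)
    obtain ⟨μ', hμ', hμi'⟩ := ih (Function.update y s 0)
    obtain ⟨h0, h1⟩ := hq s y
    refine ⟨ENNReal.ofReal (q s y) • μ + ENNReal.ofReal (1 - q s y) • μ', ⟨?_⟩, fun f hf => ?_⟩
    · simp only [Measure.coe_add, Measure.coe_smul, Pi.add_apply, Pi.smul_apply, measure_univ,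
        smul_eq_mul, mul_one]
      rw [← ENNReal.ofReal_add h0 (by linarith)]
      simp
    · rw [integral_add_measure, integral_smul_measure, integral_smul_measure, hμi f hf, hμi' f hf]
      · rw [ENNReal.toReal_ofReal h0, ENNReal.toReal_ofReal (by linarith)]
        rfl
      · exact (integrable_of_continuous hf).smul_measure ENNReal.ofReal_ne_top
      · exact (integrable_of_continuous hf).smul_measure ENNReal.ofReal_ne_top

/-- A weak limit point of the chains run over `[-n, n)` from the zero sequence. The identity at time
`s` is exact once `s` lies in the window, and it passes to the limit because `transfer` preserves
continuity. -/
lemma exists_measure_integral_eq_transfer (hq : ∀ s y, q s y ∈ Set.Icc (0 : ℝ) 1)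
    (hd : ∀ s, DependsOn (q s) (Set.Iio s)) (hc : ∀ s, Continuous (q s)) :
    ∃ μ : Measure (ℤ → Fin 2), IsProbabilityMeasure μ ∧
      ∀ (s : ℤ) (f : (ℤ → Fin 2) → ℝ), Continuous f → DependsOn f (Set.Iic s) →
        ∫ y, f y ∂μ = ∫ y, transfer (q s) s f y ∂μ := by
  choose ν hν hνi using fun n : ℕ =>
    exists_measure_integral_eq_iterTransfer hq (n : ℤ) (n + n) 0
  let νs : ℕ → ProbabilityMeasure (ℤ → Fin 2) := fun n => ⟨ν n, hν n⟩
  obtain ⟨μ, -, hμ⟩ := isCompact_univ.ultrafilter_le_nhds ((hyperfilter ℕ).map νs) (by simp)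
  refine ⟨μ, inferInstance, fun s f hf hfd => ?_⟩
  have conv : ∀ f : (ℤ → Fin 2) → ℝ, Continuous f →
      Tendsto (fun n : ℕ => iterTransfer q (n : ℤ) f (n + n) 0) (hyperfilter ℕ : Filter ℕ)
        (𝓝 (∫ y, f y ∂(μ : Measure (ℤ → Fin 2)))) := by
    intro f hf
    have := ProbabilityMeasure.tendsto_iff_forall_integral_tendsto.1
      (show Tendsto νs (hyperfilter ℕ : Filter ℕ) (𝓝 μ) from hμ)
      (BoundedContinuousFunction.mkOfCompact ⟨f, hf⟩)
    simpa [νs, hνi _ _ hf] using this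
  have hg : Continuous (transfer (q s) s f) := continuous_transfer (hc s) hf
  refine tendsto_nhds_unique (conv f hf) ((conv _ hg).congr' ?_)
  have : ∀ᶠ n : ℕ in (hyperfilter ℕ : Filter ℕ), s.natAbs + 1 ≤ n :=
    (Nat.hyperfilter_le_atTop (eventually_ge_atTop _))
  filter_upwards [this] with n hn
  -- The `n + n` resamplings split into `m` after time `s`, which act trivially, one at `s`, and `j`
  -- before it.
  obtain ⟨m, hm⟩ : ∃ m : ℕ, (m : ℤ) = n - (s + 1) := ⟨(n - (s + 1)).toNat, by omega⟩
  obtain ⟨j, hj⟩ : ∃ j : ℕ, (j : ℤ) = n + s := ⟨(n + s).toNat, by omega⟩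
  have e1 : iterTransfer q n f (n + n) = iterTransfer q (s + 1) f (1 + j) := by
    rw [← iterTransfer_shift_time (hfd.mono fun i hi => ?_) m (1 + j)]
    · congr 1 <;> omega
    · exact Int.lt_add_one_of_le hi
  have e2 : iterTransfer q n (transfer (q s) s f) (n + n)
      = iterTransfer q s (transfer (q s) s f) j := by
    rw [← iterTransfer_shift_time (DependsOn_transfer (hd s) hfd) (m + 1) j]
    congr 1 <;> push_cast <;> omega
  rw [e1, e2, iterTransfer_add]
  simp [iterTransfer]

/-- The identity passes from continuous to measurable test functions because the densities `isOne s`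
and `q`, after projection to the past of `s`, define finite measures with the same integrals of
bounded continuous functions. -/
lemma integral_mul_isOne_eq {μ : Measure (ℤ → Fin 2)} [IsProbabilityMeasure μ] {s : ℤ}
    {q : (ℤ → Fin 2) → ℝ}
    (hq : ∀ y, q y ∈ Set.Icc (0 : ℝ) 1) (hc : Continuous q)
    (hμ : ∀ f : (ℤ → Fin 2) → ℝ, Continuous f → DependsOn f (Set.Iic s) →
        ∫ y, f y ∂μ = ∫ y, transfer q s f y ∂μ)
    {f : (ℤ → Fin 2) → ℝ} (hf : Measurable f) (hfd : DependsOn f (Set.Iio s)) :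
    ∫ y, f y * isOne s y ∂μ = ∫ y, f y * q y ∂μ := by
  have dens : ∀ w : (ℤ → Fin 2) → ℝ, Measurable w → (∀ y, w y ∈ Set.Icc (0 : ℝ) 1) →
      ∀ v : (ℤ → Fin 2) → ℝ, Measurable v → DependsOn v (Set.Iio s) →
      ∫ z, v z ∂((μ.withDensity fun y => ENNReal.ofReal (w y)).map (past s))
        = ∫ y, v y * w y ∂μ := by
    intro w hw hw1 v hv hvd
    rw [integral_map (measurable_past s).aemeasurable hv.aestronglyMeasurable,
      integral_withDensity_eq_integral_toReal_smul hw.ennreal_ofReal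
        (.of_forall fun y => ENNReal.ofReal_lt_top)]
    refine integral_congr_ae (.of_forall fun y => ?_)
    simp only [smul_eq_mul]
    rw [ENNReal.toReal_ofReal (hw1 y).1, DependsOn.comp_past hvd, mul_comm]
  have fin : ∀ w : (ℤ → Fin 2) → ℝ, (∀ y, w y ∈ Set.Icc (0 : ℝ) 1) →
      IsFiniteMeasure (μ.withDensity fun y => ENNReal.ofReal (w y)) := by
    intro w hw
    refine isFiniteMeasure_withDensity (ne_of_lt ?_)
    calc ∫⁻ y, ENNReal.ofReal (w y) ∂μ ≤ ∫⁻ _, 1 ∂μ :=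
          lintegral_mono fun y => by simpa using (hw y).2
      _ < ⊤ := by simp
  have := fin (isOne s) (isOne_mem_Icc s)
  have := fin q hq
  have hmeas : (μ.withDensity fun y => ENNReal.ofReal (isOne s y)).map (past s)
      = (μ.withDensity fun y => ENNReal.ofReal (q y)).map (past s) := by
    refine ext_of_forall_integral_eq_of_IsFiniteMeasure fun v => ?_
    have key : ∀ w : (ℤ → Fin 2) → ℝ, Measurable w → (∀ y, w y ∈ Set.Icc (0 : ℝ) 1) →
        ∫ z, v z ∂((μ.withDensity fun y => ENNReal.ofReal (w y)).map (past s))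
        = ∫ y, v (past s y) * w y ∂μ := by
      intro w hw hw1
      have hm : Measurable fun y => v (past s y) :=
        (v.continuous.comp (continuous_past s)).measurable
      rw [← dens w hw hw1 (fun y => v (past s y)) hm
        (fun y y' h => by simp only [dependsOn_past s h])]
      rw [integral_map (measurable_past s).aemeasurable
          v.continuous.measurable.aestronglyMeasurable,
        integral_map (measurable_past s).aemeasurable hm.aestronglyMeasurable]
      simp only [DependsOn.comp_past (dependsOn_past s)]
    have hvd : DependsOn (fun y => v (past s y)) (Set.Iio s) :=
      fun y y' h => by simp only [dependsOn_past s h]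
    have hvc : Continuous fun y => v (past s y) := v.continuous.comp (continuous_past s)
    rw [key _ (measurable_isOne s) (isOne_mem_Icc s), key q hc.measurable hq,
      hμ (fun y => v (past s y) * isOne s y) (hvc.mul (continuous_isOne s)) ?_,
      transfer_isOne_mul hvd]
    intro y y' h
    have h' : y s = y' s := h s (Set.mem_Iic.2 le_rfl)
    have := hvd fun i (hi : i < s) => h i hi.le
    simp only [isOne, h'] at this ⊢
    rw [this]
  rw [← dens _ (measurable_isOne s) (isOne_mem_Icc s) f hf hfd, hmeas,
    dens q hc.measurable hq f hf hfd]

end Fiber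

section Kernel

variable {S : Type*} [MeasurableSpace S] {p : S → ℤ → (ℤ → Fin 2) → ℝ}

/-- It suffices to test the conditional probability against functions of the past. -/
lemma IsGibbs.of_integral_mul_isOne {ρ : Measure (S × (ℤ → Fin 2))} [IsFiniteMeasure ρ]
    (hp : IsSpecification p)
    (h : ∀ (s : ℤ) (f : S → (ℤ → Fin 2) → ℝ), Measurable (Function.uncurry f) →
      (∃ C, ∀ x y, |f x y| ≤ C) → (∀ x, DependsOn (f x) (Set.Iio s)) →
      ∫ z, f z.1 z.2 * isOne s z.2 ∂ρ = ∫ z, f z.1 z.2 * p z.1 s z.2 ∂ρ) : IsGibbs p ρ := by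
  rintro s f hf ⟨C, hC⟩ hd
  have upd : ∀ a : Fin 2,
      Measurable (Function.uncurry fun x y => f x (Function.update y s a)) := by
    intro a
    have : Measurable (fun z : S × (ℤ → Fin 2) => (z.1, Function.update z.2 s a)) := by
      refine measurable_fst.prodMk (measurable_pi_lambda _ fun i => ?_)
      rcases eq_or_ne i s with rfl | hne
      · simp
      · simp only [ne_eq, hne, not_false_eq_true, Function.update_of_ne]
        exact (measurable_pi_apply i).comp measurable_snd
    exact hf.comp this
  have updd : ∀ (a : Fin 2) x, DependsOn (fun y => f x (Function.update y s a)) (Set.Iio s) := by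
    intro a x y y' hy
    refine hd x fun i hi => ?_
    rcases eq_or_ne i s with rfl | hne
    · simp
    · simpa [hne] using hy i (lt_of_le_of_ne hi hne)
  have h1 := h s _ (upd 1) ⟨C, fun x y => hC _ _⟩ (updd 1)
  have h0 := h s _ (upd 0) ⟨C, fun x y => hC _ _⟩ (updd 0)
  have int : ∀ (a : Fin 2) (w : S × (ℤ → Fin 2) → ℝ), Measurable w →
      (∀ z, w z ∈ Set.Icc (0 : ℝ) 1) →
      Integrable (fun z => f z.1 (Function.update z.2 s a) * w z) ρ := by
    intro a w hw hw1
    refine Integrable.of_bound ((upd a).mul hw).aestronglyMeasurable C (.of_forall fun z => ?_)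
    rw [Real.norm_eq_abs, abs_mul, abs_of_nonneg (hw1 z).1]
    have := hC z.1 (Function.update z.2 s a)
    nlinarith [abs_nonneg (f z.1 (Function.update z.2 s a)), (hw1 z).1, (hw1 z).2]
  have i1 : Measurable fun z : S × (ℤ → Fin 2) => isOne s z.2 :=
    (measurable_isOne s).comp measurable_snd
  have one : ∀ a : Fin 2, Integrable (fun z => f z.1 (Function.update z.2 s a)) ρ := fun a => by
    simpa using int a 1 measurable_one (by simp)
  -- Split `f` according to the value at time `s`; both pieces are functions of the strict past,
  -- multiplied by `isOne s` or its complement.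
  have e1 : ∀ z : S × (ℤ → Fin 2), f z.1 z.2
      = f z.1 (Function.update z.2 s 1) * isOne s z.2
        + (f z.1 (Function.update z.2 s 0) - f z.1 (Function.update z.2 s 0) * isOne s z.2) := by
    intro z
    have hz : ∀ a, z.2 s = a → Function.update z.2 s a = z.2 := by
      rintro a rfl
      exact Function.update_eq_self _ _
    by_cases h : z.2 s = 1
    · simp [isOne, hz 1 h, h]
    · have h0 : z.2 s = 0 := by omega
      simp [isOne, hz 0 h0, h0]
  have e2 : ∀ z : S × (ℤ → Fin 2), transfer (p z.1 s) s (f z.1) z.2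
      = f z.1 (Function.update z.2 s 1) * p z.1 s z.2
        + (f z.1 (Function.update z.2 s 0) - f z.1 (Function.update z.2 s 0) * p z.1 s z.2) := by
    intro z
    simp only [transfer]
    ring
  have hi1 := fun a => int a _ i1 fun z => isOne_mem_Icc s z.2
  have hip := fun a => int a _ (hp.measurable s) fun z => hp.mem_Icc z.1 s z.2
  simp only [e1, e2]
  rw [integral_add (hi1 1) (by exact (one 0).sub (hi1 0)),
    integral_add (hip 1) (by exact (one 0).sub (hip 0)),
    integral_sub (one 0) (hi1 0), integral_sub (one 0) (hip 0), h1, h0]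

lemma IsGibbs.integral_mul_isOne {ρ : Measure (S × (ℤ → Fin 2))} (h : IsGibbs p ρ)
    {s : ℤ} {f : S → (ℤ → Fin 2) → ℝ} (hf : Measurable (Function.uncurry f))
    {C : ℝ} (hC : ∀ x y, |f x y| ≤ C) (hd : ∀ x, DependsOn (f x) (Set.Iio s)) :
    ∫ z, f z.1 z.2 * isOne s z.2 ∂ρ = ∫ z, f z.1 z.2 * p z.1 s z.2 ∂ρ := by
  rw [h s (fun x y => f x y * isOne s y)
    (hf.mul ((measurable_isOne s).comp measurable_snd)) ⟨C, fun x y => ?_⟩ fun x y y' hy => ?_]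
  · refine integral_congr_ae (.of_forall fun z => ?_)
    exact congrFun (transfer_isOne_mul (q := p z.1 s) (hd z.1)) z.2
  · have h0 := isOne_mem_Icc s y
    rw [abs_mul, abs_of_nonneg h0.1]
    nlinarith [hC x y, abs_nonneg (f x y), h0.1, h0.2]
  · have h' : y s = y' s := hy s (Set.mem_Iic.2 le_rfl)
    have := hd x fun i (hi : i < s) => hy i hi.le
    simp only [isOne, h', this]

lemma isGibbs_compProd (hp : IsSpecification p) {ν : Measure S} [IsProbabilityMeasure ν]
    {η : Kernel S (ℤ → Fin 2)} [IsMarkovKernel η]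
    (h : ∀ᵐ x ∂ν, ∀ (s : ℤ) (f : (ℤ → Fin 2) → ℝ), Measurable f → DependsOn f (Set.Iio s) →
      ∫ y, f y * isOne s y ∂(η x) = ∫ y, f y * p x s y ∂(η x)) :
    IsGibbs p (ν ⊗ₘ η) := by
  refine IsGibbs.of_integral_mul_isOne hp ?_
  rintro s f hf ⟨C, hC⟩ hd
  have int : ∀ w : S × (ℤ → Fin 2) → ℝ, Measurable w → (∀ z, w z ∈ Set.Icc (0 : ℝ) 1) →
      Integrable (fun z => f z.1 z.2 * w z) (ν ⊗ₘ η) := by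
    intro w hw hw1
    refine Integrable.of_bound (hf.mul hw).aestronglyMeasurable C (.of_forall fun z => ?_)
    rw [Real.norm_eq_abs, abs_mul, abs_of_nonneg (hw1 z).1]
    have := hC z.1 z.2
    nlinarith [abs_nonneg (f z.1 z.2), (hw1 z).1, (hw1 z).2]
  rw [Measure.integral_compProd (int (fun z => isOne s z.2)
      ((measurable_isOne s).comp measurable_snd) fun z => isOne_mem_Icc s z.2),
    Measure.integral_compProd (int _ (hp.measurable s) fun z => hp.mem_Icc z.1 s z.2)]
  refine integral_congr_ae ?_
  filter_upwards [h] with x hx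
  exact hx s (f x) (hf.comp measurable_prodMk_left) (hd x)

/-- The version for one fixed environment, obtained from `IsGibbs.tendsto_integral` over a one-point
environment. It identifies the law in terms of quantities that are measurable in `x`. -/
lemma tendsto_iterTransfer (hp : IsSpecification p) {x : S} (hF : Forgets (p x))
    {μ : Measure (ℤ → Fin 2)} [IsProbabilityMeasure μ]
    (hμ : ∀ (s : ℤ) (f : (ℤ → Fin 2) → ℝ), Measurable f → DependsOn f (Set.Iio s) →
      ∫ y, f y * isOne s y ∂μ = ∫ y, f y * p x s y ∂μ)
    {a t : ℤ} {h : (ℤ → Fin 2) → ℝ}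
    (hm : Measurable h) (hh : ∀ y, |h y| ≤ 1) (hd : DependsOn h (Set.Ico a t)) :
    Tendsto (fun n => iterTransfer (p x) t h n 0) atTop (𝓝 (∫ y, h y ∂μ)) := by
  have hp' : IsSpecification (fun _ : Unit => p x) :=
    ⟨fun _ => hp.mem_Icc x, fun s => (hp.measurable s).comp
      (measurable_const.prodMk measurable_snd), fun _ => hp.dependsOn x⟩
  have hG : IsGibbs (fun _ : Unit => p x) (Measure.dirac () ⊗ₘ Kernel.const Unit μ) :=
    isGibbs_compProd hp' (.of_forall fun _ => hμ)
  have := hG.tendsto_integral hp' (.of_forall fun _ => hF) MeasurableSet.univ hm hh hd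
  have hi : Integrable (fun z : Unit × (ℤ → Fin 2) => h z.2)
      (Measure.dirac () ⊗ₘ Kernel.const Unit μ) :=
    Integrable.of_bound (hm.comp measurable_snd).aestronglyMeasurable 1
      (.of_forall fun z => hh z.2)
  have e := Measure.integral_compProd hi
  simp only [integral_dirac, Kernel.const_apply] at e
  rw [← e]
  have hfst : (Measure.dirac () ⊗ₘ Kernel.const Unit μ).map Prod.fst = Measure.dirac () :=
    Measure.fst_compProd _ _
  simpa only [hfst, integral_dirac, Set.indicator_univ, Pi.one_apply, one_mul] using this

/-- Existence of a Markov kernel that gives the binary sequence the prescribed conditional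
probabilities. -/
theorem exists_kernel_isGibbs (hp : IsSpecification p) (ν : Measure S) [IsProbabilityMeasure ν]
    (hc : ∀ᵐ x ∂ν, ∀ s, Continuous (p x s)) (hF : ∀ᵐ x ∂ν, Forgets (p x)) :
    ∃ η : Kernel S (ℤ → Fin 2), IsMarkovKernel η ∧ IsGibbs p (ν ⊗ₘ η) := by
  classical
  -- A measurable set of full measure of good environments; off it the law is set to a Dirac mass to
  -- keep measurability.
  obtain ⟨G, hGsub, hGm, hG⟩ : ∃ G : Set S, (∀ x ∈ G, (∀ s, Continuous (p x s)) ∧ Forgets (p x)) ∧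
      MeasurableSet G ∧ ∀ᵐ x ∂ν, x ∈ G := by
    obtain ⟨N, hN, hNm, hN0⟩ := exists_measurable_superset_of_null (ae_iff.1 (hc.and hF))
    refine ⟨Nᶜ, fun x hx => ?_, hNm.compl, ?_⟩
    · by_contra h
      exact hx (hN h)
    · rw [ae_iff]
      simpa using hN0
  have ex : ∀ x : S, ∃ μ : Measure (ℤ → Fin 2), IsProbabilityMeasure μ ∧
      (x ∈ G → ∀ (s : ℤ) (f : (ℤ → Fin 2) → ℝ), Measurable f → DependsOn f (Set.Iio s) →
        ∫ y, f y * isOne s y ∂μ = ∫ y, f y * p x s y ∂μ) ∧ (x ∉ G → μ = Measure.dirac 0) := by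
    intro x
    by_cases hx : x ∈ G
    · obtain ⟨μ, hμ, hμi⟩ := exists_measure_integral_eq_transfer (hp.mem_Icc x) (hp.dependsOn x)
        (hGsub x hx).1
      exact ⟨μ, hμ, fun _ s f hf hfd => integral_mul_isOne_eq (hp.mem_Icc x s)
        ((hGsub x hx).1 s) (hμi s) hf hfd, fun h => absurd hx h⟩
    · exact ⟨Measure.dirac 0, inferInstance, fun h => absurd h hx, fun _ => rfl⟩
  choose μ hμ hμG hμn using ex
  -- The laws were chosen separately for each environment. They are measurable in it nevertheless,
  -- since on `G` forgetting makes their values on cylinders limits of measurable functions.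
  have hmeas : Measurable μ := by
    refine Measurable.measure_of_isPiSystem_of_isProbabilityMeasure
      (generateFrom_measurableCylinders (α := fun _ : ℤ => Fin 2)).symm
      isPiSystem_measurableCylinders fun C hC => ?_
    have hCm : MeasurableSet C := MeasurableSet.of_mem_measurableCylinders hC
    obtain ⟨a, t, hd⟩ := exists_dependsOn_Ico_of_mem_cylinders hC
    have hm : Measurable (C.indicator (1 : (ℤ → Fin 2) → ℝ)) := measurable_one.indicator hCm
    have hb : ∀ y, |C.indicator (1 : (ℤ → Fin 2) → ℝ) y| ≤ 1 := fun y => by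
      by_cases hy : y ∈ C <;> simp [hy]
    have hreal : Measurable fun x => (μ x).real C := by
      refine measurable_of_tendsto_metrizable
        (f := fun (n : ℕ) x => if x ∈ G then iterTransfer (p x) t (C.indicator 1) n 0
          else C.indicator (1 : (ℤ → Fin 2) → ℝ) 0) (fun n => ?_) ?_
      · refine Measurable.ite hGm ?_ measurable_const
        exact (hp.measurable_iterTransfer t (f := fun _ => C.indicator 1)
          (hm.comp measurable_snd) n).comp (measurable_id.prodMk measurable_const)
      · rw [tendsto_pi_nhds]
        intro x
        by_cases hx : x ∈ G
        · simp only [hx, if_true]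
          rw [← integral_indicator_one hCm]
          exact tendsto_iterTransfer hp (hGsub x hx).2 (hμG x hx) hm hb hd
        · simp only [hx, if_false, hμn x hx]
          rw [← integral_indicator_one hCm, integral_dirac]
          exact tendsto_const_nhds
    simpa [Measure.real] using hreal.ennreal_ofReal
  have : IsMarkovKernel (⟨μ, hmeas⟩ : Kernel S (ℤ → Fin 2)) := ⟨hμ⟩
  refine ⟨⟨μ, hmeas⟩, this, isGibbs_compProd hp ?_⟩
  filter_upwards [hG] with x hx
  exact hμG x hx

end Kernel

end BinaryAR

/-! ### Forgetting of the past by coupling -/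

namespace BinaryAR

/-- Coupling estimate: `h` oscillates by at most `o`, and by at most `e` between sequences that are
updated by the same value. -/
lemma abs_transfer_sub_le {q h : (ℤ → Fin 2) → ℝ} {s : ℤ} (hq : ∀ y, q y ∈ Set.Icc (0 : ℝ) 1)
    {y y' : ℤ → Fin 2} {e o : ℝ} (ho : ∀ z z', |h z - h z'| ≤ o)
    (he : ∀ a : Fin 2, |h (Function.update y s a) - h (Function.update y' s a)| ≤ e) :
    |transfer q s h y - transfer q s h y'| ≤ (1 - |q y - q y'|) * e + |q y - q y'| * o := by
  obtain ⟨a0, a1⟩ := hq y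
  obtain ⟨b0, b1⟩ := hq y'
  have h1 := abs_le.1 (he 1)
  have h0 := abs_le.1 (he 0)
  have h10 := abs_le.1 (ho (Function.update y s 1) (Function.update y' s 0))
  have h01 := abs_le.1 (ho (Function.update y s 0) (Function.update y' s 1))
  simp only [transfer]
  generalize h (Function.update y s 1) = u1 at *
  generalize h (Function.update y s 0) = u0 at *
  generalize h (Function.update y' s 1) = v1 at *
  generalize h (Function.update y' s 0) = v0 at *
  generalize q y = a at *
  generalize q y' = b at *
  -- Maximal coupling of the two draws: both are `1` with probability `min a b`, both are `0` with
  -- probability `1 - max a b`, and they differ with probability `|a - b|`.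
  rcases le_total a b with hab | hab
  · rw [abs_of_nonpos (by linarith : a - b ≤ 0), abs_le]
    have w1 : 0 ≤ b - a := by linarith
    have w2 : 0 ≤ 1 - b := by linarith
    have id : a * u1 + (1 - a) * u0 - (b * v1 + (1 - b) * v0)
        = a * (u1 - v1) + (1 - b) * (u0 - v0) + (b - a) * (u0 - v1) := by ring
    rw [id]
    constructor
    · linarith [mul_le_mul_of_nonneg_left h1.1 a0, mul_le_mul_of_nonneg_left h0.1 w2,
        mul_le_mul_of_nonneg_left h01.1 w1]
    · linarith [mul_le_mul_of_nonneg_left h1.2 a0, mul_le_mul_of_nonneg_left h0.2 w2,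
        mul_le_mul_of_nonneg_left h01.2 w1]
  · rw [abs_of_nonneg (by linarith : 0 ≤ a - b), abs_le]
    have w1 : 0 ≤ a - b := by linarith
    have w2 : 0 ≤ 1 - a := by linarith
    have id : a * u1 + (1 - a) * u0 - (b * v1 + (1 - b) * v0)
        = b * (u1 - v1) + (1 - a) * (u0 - v0) + (a - b) * (u1 - v0) := by ring
    rw [id]
    constructor
    · linarith [mul_le_mul_of_nonneg_left h1.1 b0, mul_le_mul_of_nonneg_left h0.1 w2,
        mul_le_mul_of_nonneg_left h10.1 w1]
    · linarith [mul_le_mul_of_nonneg_left h1.2 b0, mul_le_mul_of_nonneg_left h0.2 w2,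
        mul_le_mul_of_nonneg_left h10.2 w1]

/-- The oscillation of `h` between sequences that agree on `[s, r)` is at most `e`. -/
def OscLE (s r : ℤ) (h : (ℤ → Fin 2) → ℝ) (e : ℝ) : Prop :=
  ∀ y y' : ℤ → Fin 2, (∀ i, s ≤ i → i < r → y i = y' i) → |h y - h y'| ≤ e

lemma OscLE.update {s r : ℤ} {h : (ℤ → Fin 2) → ℝ} {e : ℝ} (H : OscLE s (r + 1) h e)
    {y y' : ℤ → Fin 2} (hy : ∀ i, s ≤ i → i < r → y i = y' i) (a : Fin 2) :
    |h (Function.update y r a) - h (Function.update y' r a)| ≤ e := by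
  refine H _ _ fun i hi hir => ?_
  rcases eq_or_ne i r with rfl | hne
  · simp
  · simpa [hne] using hy i hi (by omega)

/-- The coupled updates differ with probability at most `δ`, at a cost of at most `o`. -/
lemma OscLE.transfer_add {q h : (ℤ → Fin 2) → ℝ} {s r : ℤ} (hq : ∀ y, q y ∈ Set.Icc (0 : ℝ) 1)
    {e o δ : ℝ} (he : 0 ≤ e) (ho : ∀ z z', |h z - h z'| ≤ o) (H : OscLE s (r + 1) h e)
    (hδ : OscLE s r q δ) : OscLE s r (transfer q r h) (e + δ * o) := by
  intro y y' hy
  have h1 := abs_transfer_sub_le hq ho (H.update hy)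
  have h2 := hδ y y' hy
  have o0 : 0 ≤ o := (abs_nonneg _).trans (ho y y)
  have := mul_le_mul_of_nonneg_right h2 o0
  nlinarith [mul_nonneg (abs_nonneg (q y - q y')) he]

/-- Both probabilities lie in `[c, 1]`, so the coupled updates agree with probability at least `c`.
-/
lemma OscLE.transfer_convex {q h : (ℤ → Fin 2) → ℝ} {s r : ℤ}
    (hq : ∀ y, q y ∈ Set.Icc (0 : ℝ) 1)
    {e o c : ℝ} (heo : e ≤ o) (ho : ∀ z z', |h z - h z'| ≤ o) (H : OscLE s (r + 1) h e)
    (hc : ∀ y, c ≤ q y) : OscLE s r (transfer q r h) (c * e + (1 - c) * o) := by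
  intro y y' hy
  have h1 := abs_transfer_sub_le hq ho (H.update hy)
  have h2 : |q y - q y'| ≤ 1 - c := by
    have := (hq y).2
    have := (hq y').2
    have := hc y
    have := hc y'
    rw [abs_le]
    constructor <;> linarith
  nlinarith [mul_le_mul_of_nonneg_right h2 (sub_nonneg.2 heo)]

/-- Forgetting of the initial condition: the conditional probabilities depend on the remote past at
a geometric rate, up to a factor `M s` that is recurrently small, and recurrently stay away
from `0`. -/
theorem forgets_of_recurrent {q : ℤ → (ℤ → Fin 2) → ℝ} (hq : ∀ s y, q s y ∈ Set.Icc (0 : ℝ) 1)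
    {M : ℤ → ℝ} {C κ : ℝ} (hC : 0 ≤ C) (hκ₀ : 0 < κ) (hκ₁ : κ < 1)
    (hM : ∀ (s : ℤ) (n : ℕ), OscLE s (s + n) (q (s + n)) (C * κ ^ n * M s))
    {c k : ℝ} {N : ℕ} (hc : 0 < c) (hk : 0 ≤ k) (hN : C * k / (1 - κ) * κ ^ N ≤ 1 / 2)
    (hrec : ∀ s₀ : ℤ, ∃ s ≤ s₀, M s ≤ k ∧ ∀ j < N, ∀ y, c ≤ q (s + (j : ℕ)) y) :
    Forgets q := by
  intro a t h hh hd
  set u := iterTransfer q t h with hu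
  -- `B` is the sum of the series of discrepancies `C * k * κ ^ j`, and `B * κ ^ j` its tail,
  -- bounding the chance to separate after `j` steps of agreement since a good time.
  set B := C * k / (1 - κ) with hB
  have hκ' : 0 < 1 - κ := by linarith
  have hB0 : 0 ≤ B := by positivity
  have hBk : B * κ + C * k = B := by
    rw [hB]
    field_simp
    ring
  -- For `N = 0` nothing bounds `c`, but only `c ^ N ≤ 1` is needed.
  have hc1 : c ≤ 1 ∨ N = 0 := by
    rcases Nat.eq_zero_or_pos N with h0 | h0
    · exact .inr h0
    · obtain ⟨s, -, -, hs⟩ := hrec 0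
      exact .inl ((hs 0 h0 0).trans (hq _ _).2)
  have usucc : ∀ (n : ℕ) (r : ℤ), t - n = r + 1 → u (n + 1) = transfer (q r) r (u n) := by
    intro n r hr
    have : t - ((n + 1 : ℕ) : ℤ) = r := by push_cast; omega
    rw [hu, iterTransfer, this]
  have u2 : ∀ n y y', |u n y - u n y'| ≤ 2 := fun n y y' => by
    have h1 := abs_iterTransfer_le (t := t) hq hh n y
    have h2 := abs_iterTransfer_le (t := t) hq hh n y'
    have := abs_sub (u n y) (u n y')
    linarith
  have lip : ∀ (s : ℤ) (j : ℕ), M s ≤ k → OscLE s (s + j) (q (s + j)) (C * κ ^ j * k) := by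
    intro s j hs y y' hy
    refine (hM s j y y' hy).trans ?_
    gcongr
  -- Sum the separation probabilities up to time `t`, with the crude cost `2` for each. Since `s ≤
  -- a`, sequences that agree on `[s, t)` give `h` the same value.
  have far : ∀ s : ℤ, s ≤ a → M s ≤ k → ∀ (n j : ℕ), t - n = s + j →
      OscLE s (s + j) (u n) (2 * B * κ ^ j) := by
    intro s hsa hs n
    induction n with
    | zero =>
      intro j hj y y' hy
      have : h y = h y' := hd fun i hi => hy i (hsa.trans hi.1) (by
        have := hi.2
        push_cast at hj
        omega)
      rw [hu, iterTransfer, this, sub_self, abs_zero]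
      positivity
    | succ n ih =>
      intro j hj
      have ih' := ih (j + 1) (by push_cast at hj ⊢; omega)
      rw [usucc n (s + j) (by push_cast at hj; omega)]
      have e : s + ((j + 1 : ℕ) : ℤ) = s + j + 1 := by push_cast; ring
      rw [e] at ih'
      have := ih'.transfer_add (hq _) (by positivity) (u2 n) (lip s j hs)
      have e2 : 2 * B * κ ^ (j + 1) + C * κ ^ j * k * 2 = 2 * B * κ ^ j := by
        rw [pow_succ]
        linear_combination 2 * κ ^ j * hBk
      rwa [e2] at this
  -- Before time `s + L` a separation costs only the oscillation `o` already achieved; the crude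
  -- cost is confined to the small term `2 * B * κ ^ L`.
  have middle : ∀ (s : ℤ) (L n₀ : ℕ) (o : ℝ), s ≤ a → M s ≤ k → t - n₀ = s + L →
      (∀ n, n₀ ≤ n → ∀ y y', |u n y - u n y'| ≤ o) →
      ∀ m j : ℕ, j + m = L → OscLE s (s + j) (u (n₀ + m)) (2 * B * κ ^ L + B * κ ^ j * o) := by
    intro s L n₀ o hsa hs hn₀ ho m
    have o0 : 0 ≤ o := (abs_nonneg _).trans (ho n₀ le_rfl 0 0)
    induction m with
    | zero =>
      intro j hj y y' hy
      obtain rfl : j = L := by omega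
      have := far s hsa hs n₀ j hn₀ y y' hy
      have : 0 ≤ B * κ ^ j * o := by positivity
      rw [add_zero]
      linarith
    | succ m ih =>
      intro j hj
      have ih' := ih (j + 1) (by omega)
      rw [← add_assoc, usucc (n₀ + m) (s + j) (by push_cast; omega)]
      have e : s + ((j + 1 : ℕ) : ℤ) = s + j + 1 := by push_cast; ring
      rw [e] at ih'
      have := ih'.transfer_add (hq _) (by positivity) (ho _ (by omega)) (lip s j hs)
      have e2 : 2 * B * κ ^ L + B * κ ^ (j + 1) * o + C * κ ^ j * k * o
          = 2 * B * κ ^ L + B * κ ^ j * o := by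
        rw [pow_succ]
        linear_combination κ ^ j * o * hBk
      rwa [e2] at this
  -- On `[s, s + N)` agreement is not given: each step achieves it with probability at least `c`, so
  -- the gain `o / 4` survives with the factor `c ^ N` when no common past is required.
  have near : ∀ (s : ℤ) (n₁ : ℕ) (o : ℝ), (∀ j < N, ∀ y, c ≤ q (s + (j : ℕ)) y) →
      t - n₁ = s + N → (∀ n, n₁ ≤ n → ∀ y y', |u n y - u n y'| ≤ o) →
      OscLE s (s + N) (u n₁) (3 / 4 * o) →
      ∀ m j : ℕ, j + m = N → OscLE s (s + j) (u (n₁ + m)) (o - c ^ m * (o / 4)) := by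
    intro s n₁ o hs hn₁ ho hbase m
    have o0 : 0 ≤ o := (abs_nonneg _).trans (ho n₁ le_rfl 0 0)
    induction m with
    | zero =>
      intro j hj
      obtain rfl : j = N := by omega
      have e : o - c ^ 0 * (o / 4) = 3 / 4 * o := by ring
      rwa [e, add_zero]
    | succ m ih =>
      intro j hj
      have ih' := ih (j + 1) (by omega)
      rw [← add_assoc, usucc (n₁ + m) (s + j) (by push_cast; omega)]
      have e : s + ((j + 1 : ℕ) : ℤ) = s + j + 1 := by push_cast; ring
      rw [e] at ih'
      have hle : o - c ^ m * (o / 4) ≤ o := by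
        have : 0 ≤ c ^ m * (o / 4) := by positivity
        linarith
      have := ih'.transfer_convex (hq _) hle (ho _ (by omega)) (hs j (by omega))
      have e2 : c * (o - c ^ m * (o / 4)) + (1 - c) * o = o - c ^ (m + 1) * (o / 4) := by ring
      rwa [e2] at this
  set θ := 1 - c ^ N / 4 with hθ
  have hcN : c ^ N ≤ 1 := by
    rcases hc1 with h1 | h1
    · exact pow_le_one₀ hc.le h1
    · simp [h1]
  have hcN0 : 0 < c ^ N := by positivity
  have hθ1 : θ < 1 := by rw [hθ]; linarith
  have hθ0 : 0 < θ := by rw [hθ]; linarith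
  have contraction : ∀ (n₀ : ℕ) (o : ℝ), 0 < o → (∀ y y', |u n₀ y - u n₀ y'| ≤ o) →
      ∃ n, ∀ y y', |u n y - u n y'| ≤ θ * o := by
    intro n₀ o ho hn₀
    have ho' : ∀ n, n₀ ≤ n → ∀ y y', |u n y - u n y'| ≤ o := by
      intro n hn
      obtain ⟨j, rfl⟩ := Nat.exists_eq_add_of_le hn
      rw [hu, iterTransfer_add]
      exact osc_iterTransfer_le hq hn₀ j
    -- With this `L`, the bound of `middle` at `j = N` is at most `o / 4 + o / 2`, the `3 / 4 * o`
    -- required by `near`.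
    obtain ⟨L, hLN, hL⟩ : ∃ L, N ≤ L ∧ 2 * B * κ ^ L ≤ o / 4 := by
      have : Tendsto (fun L : ℕ => 2 * B * κ ^ L) atTop (𝓝 (2 * B * 0)) :=
        (tendsto_pow_atTop_nhds_zero_of_lt_one hκ₀.le hκ₁).const_mul _
      rw [mul_zero] at this
      exact ((eventually_ge_atTop N).and
        (this.eventually_le_const (by positivity : 0 < o / 4))).exists
    -- The good time must precede the support of `h`, and `s + L` must not exceed `t - n₀`, so that
    -- the oscillation bound `o` is available there.
    obtain ⟨s, hs, hMs, hsq⟩ := hrec (min a (t - n₀ - L))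
    have hsa : s ≤ a := hs.trans (min_le_left _ _)
    have hst : s ≤ t - n₀ - L := hs.trans (min_le_right _ _)
    obtain ⟨n₂, hn₂⟩ : ∃ n₂ : ℕ, t - n₂ = s + L := ⟨(t - s - L).toNat, by omega⟩
    have hn02 : n₀ ≤ n₂ := by omega
    have hmid := middle s L n₂ o hsa hMs hn₂ (fun n hn => ho' n (hn02.trans hn)) (L - N) N
      (by omega)
    have hbase : OscLE s (s + N) (u (n₂ + (L - N))) (3 / 4 * o) := by
      intro y y' hy
      refine (hmid y y' hy).trans ?_
      have := mul_le_mul_of_nonneg_right hN ho.le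
      linarith
    have hnear := near s (n₂ + (L - N)) o hsq (by push_cast [Nat.cast_sub hLN]; omega)
      (fun n hn => ho' n (by omega)) hbase N 0 (by omega)
    refine ⟨n₂ + (L - N) + N, fun y y' => ?_⟩
    refine (hnear y y' fun i hi hi' => ?_).trans_eq ?_
    · push_cast at hi'
      omega
    · rw [hθ]
      ring
  have iter : ∀ m : ℕ, ∃ n, ∀ y y', |u n y - u n y'| ≤ θ ^ m * 2 := by
    intro m
    induction m with
    | zero => exact ⟨0, fun y y' => by simpa using u2 0 y y'⟩
    | succ m ih =>
      obtain ⟨n, hn⟩ := ih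
      obtain ⟨n', hn'⟩ := contraction n _ (by positivity) hn
      exact ⟨n', fun y y' => (hn' y y').trans_eq (by ring)⟩
  intro ε hε
  have : Tendsto (fun m : ℕ => θ ^ m * 2) atTop (𝓝 (0 * 2)) :=
    (tendsto_pow_atTop_nhds_zero_of_lt_one hθ0.le hθ1).mul_const _
  rw [zero_mul] at this
  obtain ⟨m, hm⟩ := (this.eventually_le_const hε).exists
  obtain ⟨n, hn⟩ := iter m
  exact ⟨n, fun y y' => (hn y y').trans hm⟩

end BinaryAR

/-! ### The latent process started from the remote past -/

namespace BinaryAR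

/-- The latent process at time `t`, started from `0` at time `t - n`. -/
noncomputable def latentIter (g : ℝ → ℝ) (α : ℝ) (w : ℤ → ℝ) (y : ℤ → Fin 2) : ℕ → ℤ → ℝ
  | 0, _ => 0
  | n + 1, t => g (latentIter g α w y n (t - 1)) + α * isOne (t - 1) y + w t

/-- The latent process at time `t`, started from the infinitely remote past. -/
noncomputable def latent (g : ℝ → ℝ) (α : ℝ) (w : ℤ → ℝ) (t : ℤ) (y : ℤ → Fin 2) : ℝ :=
  limUnder atTop fun n => latentIter g α w y n t

/-- Exponentially weighted sum of the past of `w`. -/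
noncomputable def discounted (κ b : ℝ) (w : ℤ → ℝ) (t : ℤ) : ℝ :=
  ∑' i : ℕ, κ ^ i * (b + |w (t - i)|)

/-- The exponentially weighted sums of the past of `w` converge. -/
def IsTame (κ : ℝ) (w : ℤ → ℝ) : Prop := ∀ t : ℤ, Summable fun i : ℕ => κ ^ i * |w (t - i)|

section Measurability

variable {Ω : Type*} [MeasurableSpace Ω] {w : Ω → ℤ → ℝ} {y : Ω → ℤ → Fin 2} {g : ℝ → ℝ}

lemma measurable_latentIter (hg : Measurable g) (hw : Measurable w) (hy : Measurable y) (α : ℝ)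
    (n : ℕ) (t : ℤ) : Measurable fun ω => latentIter g α (w ω) (y ω) n t := by
  induction n generalizing t with
  | zero => exact measurable_const
  | succ n ih =>
    exact ((hg.comp (ih (t - 1))).add (((measurable_isOne (t - 1)).comp hy).const_mul α)).add
      ((measurable_pi_apply t).comp hw)

lemma measurable_latent (hg : Measurable g) (hw : Measurable w) (hy : Measurable y) (α : ℝ)
    (t : ℤ) : Measurable fun ω => latent g α (w ω) t (y ω) :=
  (StronglyMeasurable.limUnder
    fun n => (measurable_latentIter hg hw hy α n t).stronglyMeasurable).measurable

end Measurability

lemma measurable_discounted (κ b : ℝ) (t : ℤ) :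
    Measurable fun w : ℤ → ℝ => discounted κ b w t := by
  refine Measurable.tsum fun i => ?_
  exact (measurable_const.add (measurable_pi_apply _).abs).const_mul _

lemma latentIter_shift (g : ℝ → ℝ) (α : ℝ) (w : ℤ → ℝ) (y : ℤ → Fin 2) (n : ℕ) (t : ℤ) :
    latentIter g α (shift w) (shift y) n t = latentIter g α w y n (t + 1) := by
  induction n generalizing t with
  | zero => rfl
  | succ n ih =>
    simp only [latentIter, ih]
    have e : t - 1 + 1 = t + 1 - 1 := by ring
    simp only [isOne, shift, e]

lemma latent_shift (g : ℝ → ℝ) (α : ℝ) (w : ℤ → ℝ) (y : ℤ → Fin 2) (t : ℤ) :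
    latent g α (shift w) t (shift y) = latent g α w (t + 1) y := by
  simp only [latent, latentIter_shift]

lemma discounted_shift (κ b : ℝ) (w : ℤ → ℝ) (t : ℤ) :
    discounted κ b (shift w) t = discounted κ b w (t + 1) := by
  unfold discounted
  congr 1
  funext i
  have e : t - i + 1 = t + 1 - i := by ring
  simp only [shift, e]

section Fixed

variable {g : ℝ → ℝ} {κ α : ℝ} {w : ℤ → ℝ}

lemma dependsOn_latentIter (n : ℕ) (t : ℤ) :
    DependsOn (fun y => latentIter g α w y n t) (Set.Iio t) := by
  induction n generalizing t with
  | zero => exact fun _ _ _ => rfl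
  | succ n ih =>
    intro y y' hy
    have h1 := ih (t - 1) fun i hi => hy i (lt_trans (Set.mem_Iio.1 hi) (by omega))
    have h2 : y (t - 1) = y' (t - 1) := hy _ (Set.mem_Iio.2 (by omega))
    simp only at h1
    simp only [latentIter, h1, isOne, h2]

lemma dependsOn_latent (t : ℤ) : DependsOn (latent g α w t) (Set.Iio t) := by
  intro y y' hy
  have : ∀ n, latentIter g α w y n t = latentIter g α w y' n t :=
    fun n => dependsOn_latentIter n t hy
  simp only [latent, this]

lemma continuous_latentIter (hg : Continuous g) (n : ℕ) (t : ℤ) :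
    Continuous fun y => latentIter g α w y n t := by
  induction n generalizing t with
  | zero => exact continuous_const
  | succ n ih =>
    exact ((hg.comp (ih (t - 1))).add (continuous_const.mul (continuous_isOne (t - 1)))).add
      continuous_const

/-- Two solutions of the same recursion approach each other at a geometric rate. -/
lemma abs_sub_le_pow_mul (hκ : 0 ≤ κ) (hg : ∀ s s' : ℝ, |g s - g s'| ≤ κ * |s - s'|)
    {a b v : ℤ → ℝ} {s : ℤ} (n : ℕ)
    (h : ∀ t, s < t → t ≤ s + n → a t = g (a (t - 1)) + v t ∧ b t = g (b (t - 1)) + v t) :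
    |a (s + n) - b (s + n)| ≤ κ ^ n * |a s - b s| := by
  induction n with
  | zero => simp
  | succ n ih =>
    have ih' := ih fun t h1 h2 => h t h1 (by push_cast; omega)
    obtain ⟨ha, hb⟩ := h (s + (n + 1 : ℕ)) (by push_cast; omega) le_rfl
    have e : s + ((n + 1 : ℕ) : ℤ) - 1 = s + n := by push_cast; ring
    rw [ha, hb, e, add_sub_add_right_eq_sub]
    calc |g (a (s + n)) - g (b (s + n))| ≤ κ * |a (s + n) - b (s + n)| := hg _ _
      _ ≤ κ * (κ ^ n * |a s - b s|) := mul_le_mul_of_nonneg_left ih' hκ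
      _ = κ ^ (n + 1) * |a s - b s| := by ring

/-- One more step of history changes the value at time `t - n` from `0` to `g 0` plus one input, and
the contraction damps this change by `κ ^ n`. -/
lemma abs_latentIter_succ_sub_le (hκ : 0 ≤ κ) (hg : ∀ s s' : ℝ, |g s - g s'| ≤ κ * |s - s'|)
    (y : ℤ → Fin 2) (n : ℕ) (t : ℤ) :
    |latentIter g α w y (n + 1) t - latentIter g α w y n t|
      ≤ κ ^ n * (|g 0| + |α| + |w (t - n)|) := by
  induction n generalizing t with
  | zero =>
    have h0 := isOne_mem_Icc (t - 1) y
    have h1 : |α * isOne (t - 1) y| ≤ |α| := by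
      rw [abs_mul, abs_of_nonneg h0.1]
      exact mul_le_of_le_one_right (abs_nonneg _) h0.2
    have h2 := abs_add_three (g 0) (α * isOne (t - 1) y) (w t)
    simp only [latentIter, Nat.cast_zero, sub_zero, pow_zero, one_mul]
    linarith
  | succ n ih =>
    have ih' := ih (t - 1)
    have e : t - 1 - (n : ℤ) = t - ((n + 1 : ℕ) : ℤ) := by push_cast; ring
    rw [e] at ih'
    calc |latentIter g α w y (n + 1 + 1) t - latentIter g α w y (n + 1) t|
        = |g (latentIter g α w y (n + 1) (t - 1)) - g (latentIter g α w y n (t - 1))| := by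
          have e1 : ∀ m, latentIter g α w y (m + 1) t
              = g (latentIter g α w y m (t - 1)) + α * isOne (t - 1) y + w t := fun _ => rfl
          rw [e1, e1]
          congr 1
          ring
      _ ≤ κ * |latentIter g α w y (n + 1) (t - 1) - latentIter g α w y n (t - 1)| := hg _ _
      _ ≤ κ * (κ ^ n * (|g 0| + |α| + |w (t - (n + 1 : ℕ))|)) :=
          mul_le_mul_of_nonneg_left ih' hκ
      _ = _ := by ring

lemma IsTame.summable (hw : IsTame κ w) (hκ₀ : 0 ≤ κ) (hκ₁ : κ < 1) (b : ℝ) (t : ℤ) :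
    Summable fun i : ℕ => κ ^ i * (b + |w (t - i)|) := by
  simp only [mul_add]
  exact ((summable_geometric_of_lt_one hκ₀ hκ₁).mul_right b).add (hw t)

lemma IsTame.tendsto_latentIter (hw : IsTame κ w) (hκ₀ : 0 ≤ κ) (hκ₁ : κ < 1)
    (hg : ∀ s s' : ℝ, |g s - g s'| ≤ κ * |s - s'|) (y : ℤ → Fin 2) (t : ℤ) :
    Tendsto (fun n => latentIter g α w y n t) atTop (𝓝 (latent g α w t y)) := by
  refine CauchySeq.tendsto_limUnder (cauchySeq_of_dist_le_of_summable
    (fun n : ℕ => κ ^ n * (|g 0| + |α| + |w (t - n)|)) (fun n => ?_) (hw.summable hκ₀ hκ₁ _ t))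
  rw [dist_comm, Real.dist_eq]
  exact abs_latentIter_succ_sub_le hκ₀ hg y n t

/-- The bound is free of `y`. It therefore gives uniform convergence, hence continuity of `latent`
in `y`, and for `n = 0` a bound on `latent` uniform in the responses. -/
lemma IsTame.dist_latentIter_latent_le (hw : IsTame κ w) (hκ₀ : 0 ≤ κ) (hκ₁ : κ < 1)
    (hg : ∀ s s' : ℝ, |g s - g s'| ≤ κ * |s - s'|) (y : ℤ → Fin 2) (t : ℤ) (n : ℕ) :
    dist (latentIter g α w y n t) (latent g α w t y)
      ≤ ∑' m : ℕ, κ ^ (n + m) * (|g 0| + |α| + |w (t - (n + m : ℕ))|) :=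
  dist_le_tsum_of_dist_le_of_tendsto (fun n : ℕ => κ ^ n * (|g 0| + |α| + |w (t - n)|))
    (fun n => by
      rw [dist_comm, Real.dist_eq]
      exact abs_latentIter_succ_sub_le hκ₀ hg y n t)
    (hw.summable hκ₀ hκ₁ _ t) (hw.tendsto_latentIter hκ₀ hκ₁ hg y t) n

lemma IsTame.abs_latent_le (hw : IsTame κ w) (hκ₀ : 0 ≤ κ) (hκ₁ : κ < 1)
    (hg : ∀ s s' : ℝ, |g s - g s'| ≤ κ * |s - s'|) (y : ℤ → Fin 2) (t : ℤ) :
    |latent g α w t y| ≤ discounted κ (|g 0| + |α|) w t := by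
  have := hw.dist_latentIter_latent_le (α := α) hκ₀ hκ₁ hg y t 0
  simpa [latentIter, Real.dist_eq, discounted] using this

lemma continuous_of_contraction (hg : ∀ s s' : ℝ, |g s - g s'| ≤ κ * |s - s'|) :
    Continuous g := by
  refine (LipschitzWith.of_dist_le_mul (K := κ.toNNReal) fun s s' => ?_).continuous
  rw [Real.dist_eq, Real.dist_eq]
  exact (hg s s').trans (mul_le_mul_of_nonneg_right (Real.le_coe_toNNReal κ) (abs_nonneg _))

lemma IsTame.continuous_latent (hw : IsTame κ w) (hκ₀ : 0 ≤ κ) (hκ₁ : κ < 1)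
    (hg : ∀ s s' : ℝ, |g s - g s'| ≤ κ * |s - s'|) (t : ℤ) :
    Continuous (latent g α w t) := by
  have hu : TendstoUniformly (fun n y => latentIter g α w y n t) (latent g α w t) atTop := by
    rw [Metric.tendstoUniformly_iff]
    intro ε hε
    have h0 := tendsto_sum_nat_add fun i : ℕ => κ ^ i * (|g 0| + |α| + |w (t - i)|)
    filter_upwards [h0.eventually_lt_const hε] with n hn y
    rw [dist_comm]
    refine (hw.dist_latentIter_latent_le hκ₀ hκ₁ hg y t n).trans_lt ?_
    simpa only [add_comm n] using hn
  exact hu.continuous (Frequently.of_forall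
    fun n => continuous_latentIter (continuous_of_contraction hg) n t)

lemma IsTame.latent_eq (hw : IsTame κ w) (hκ₀ : 0 ≤ κ) (hκ₁ : κ < 1)
    (hg : ∀ s s' : ℝ, |g s - g s'| ≤ κ * |s - s'|) (y : ℤ → Fin 2) (t : ℤ) :
    latent g α w t y = g (latent g α w (t - 1) y) + α * isOne (t - 1) y + w t := by
  have h1 := (tendsto_add_atTop_iff_nat 1).2 (hw.tendsto_latentIter (α := α) hκ₀ hκ₁ hg y t)
  have h2 := ((continuous_of_contraction hg).tendsto _).comp
    (hw.tendsto_latentIter (α := α) hκ₀ hκ₁ hg y (t - 1))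
  exact tendsto_nhds_unique h1 ((h2.add_const _).add_const _)

/-- Forgetting of the initial condition in a tame environment whose discounted sums are recurrently
bounded. -/
theorem IsTame.forgets {F : ℝ → ℝ} (hF : Monotone F) (hFpos : ∀ s, 0 < F s) (hF1 : ∀ s, F s ≤ 1)
    {K : NNReal} (hFlip : LipschitzWith K F)
    (hw : IsTame κ w) (hκ₀ : 0 < κ) (hκ₁ : κ < 1)
    (hg : ∀ s s' : ℝ, |g s - g s'| ≤ κ * |s - s'|)
    {k k' : ℝ} {N : ℕ} (hk : 0 ≤ k) (hN : 2 * K * k / (1 - κ) * κ ^ N ≤ 1 / 2)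
    (hrec : ∀ s₀ : ℤ, ∃ s ≤ s₀, discounted κ (|g 0| + |α|) w s ≤ k ∧
      ∀ j < N, discounted κ (|g 0| + |α|) w (s + (j : ℕ)) ≤ k') :
    Forgets fun t y => F (latent g α w t y) := by
  -- The discounted sum bounds `latent` for every `y`, so two latent values at time `s` differ by at
  -- most twice that sum. Where the sum is at most `k'`, monotonicity gives `F (-k')` as a lower
  -- bound.
  refine forgets_of_recurrent (M := discounted κ (|g 0| + |α|) w) (C := 2 * K) (κ := κ)
    (c := F (-k')) (k := k) (N := N) (fun s y => ⟨(hFpos _).le, hF1 _⟩) (by positivity) hκ₀ hκ₁ ?_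
    (hFpos _) hk hN fun s₀ => ?_
  · intro s n y y' hy
    have h1 := abs_sub_le_pow_mul hκ₀.le hg (a := fun t => latent g α w t y)
      (b := fun t => latent g α w t y') (v := fun t => α * isOne (t - 1) y + w t) (s := s) n
      fun t ht ht' => by
        have e : isOne (t - 1) y = isOne (t - 1) y' := by
          simp only [isOne, hy (t - 1) (by omega) (by omega)]
        refine ⟨?_, ?_⟩
        · rw [hw.latent_eq hκ₀.le hκ₁ hg, add_assoc]
        · rw [hw.latent_eq hκ₀.le hκ₁ hg, add_assoc, e]
    have h2 := hFlip.dist_le_mul (latent g α w (s + n) y) (latent g α w (s + n) y')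
    rw [Real.dist_eq, Real.dist_eq] at h2
    have h3 : |latent g α w s y - latent g α w s y'| ≤ 2 * discounted κ (|g 0| + |α|) w s := by
      have a1 := hw.abs_latent_le (α := α) hκ₀.le hκ₁ hg y s
      have a2 := hw.abs_latent_le (α := α) hκ₀.le hκ₁ hg y' s
      have := abs_sub (latent g α w s y) (latent g α w s y')
      linarith
    calc |F (latent g α w (s + n) y) - F (latent g α w (s + n) y')|
        ≤ K * |latent g α w (s + n) y - latent g α w (s + n) y'| := h2
      _ ≤ K * (κ ^ n * (2 * discounted κ (|g 0| + |α|) w s)) := by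
          gcongr
          exact h1.trans (by gcongr)
      _ = 2 * K * κ ^ n * discounted κ (|g 0| + |α|) w s := by ring
  · obtain ⟨s, hs, hsk, hsj⟩ := hrec s₀
    refine ⟨s, hs, hsk, fun j hj y => hF ?_⟩
    have := (abs_le.1 (hw.abs_latent_le (α := α) hκ₀.le hκ₁ hg y (s + (j : ℕ)))).1
    linarith [hsj j hj]

end Fixed

end BinaryAR

/-! ### Stationary environments: recurrence and subexponential growth -/

namespace BinaryAR

lemma measurable_shift {S : Type*} [MeasurableSpace S] :
    Measurable (shift : (ℤ → S) → ℤ → S) :=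
  measurable_pi_lambda _ fun t => measurable_pi_apply (t + 1)

section Environment

variable {E : Type*} [MeasurableSpace E] {ν : Measure (ℤ → E)}

/-- The marginal laws of a stationary sequence of functionals of a stationary sequence agree. -/
lemma map_eq_of_invariant {β : Type*} [MeasurableSpace β] (hν : MeasurePreserving shift ν ν)
    {m : (ℤ → E) → ℤ → β} (hm : ∀ t, Measurable fun x => m x t)
    (hms : ∀ x t, m (shift x) t = m x (t + 1)) (t : ℤ) :
    ν.map (fun x => m x t) = ν.map (fun x => m x 0) := by
  have step : ∀ t : ℤ, ν.map (fun x => m x (t + 1)) = ν.map (fun x => m x t) := by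
    intro t
    conv_rhs => rw [← hν.map_eq]
    rw [Measure.map_map (hm t) measurable_shift]
    simp only [Function.comp_def, hms]
  induction t using Int.induction_on with
  | zero => rfl
  | succ n ih => rw [step, ih]
  | pred n ih => rw [← ih, ← step, sub_add_cancel]

/-- Good times are needed arbitrarily far in the past, so Poincaré recurrence is applied to the
backward shift. -/
lemma measurePreserving_backward (hν : MeasurePreserving shift ν ν) :
    MeasurePreserving (fun (x : ℤ → E) (t : ℤ) => x (t - 1)) ν ν := by
  have hm : Measurable (fun (x : ℤ → E) (t : ℤ) => x (t - 1)) :=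
    measurable_pi_lambda _ fun t => measurable_pi_apply (t - 1)
  refine ⟨hm, ?_⟩
  conv_lhs => rw [← hν.map_eq]
  rw [Measure.map_map hm measurable_shift]
  have : (fun (x : ℤ → E) (t : ℤ) => x (t - 1)) ∘ shift = id := by
    funext x t
    simp [shift]
  rw [this, Measure.map_id]

/-- A stationary sequence of functionals is almost surely recurrently bounded in the past, on time
windows whose length depends on the bound. -/
lemma ae_recurrent [IsFiniteMeasure ν] (hν : MeasurePreserving shift ν ν)
    {m : (ℤ → E) → ℤ → ℝ} (hm : ∀ t, Measurable fun x => m x t)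
    (hms : ∀ x t, m (shift x) t = m x (t + 1)) {κ : ℝ} (hκ₀ : 0 ≤ κ) (hκ₁ : κ < 1) (C : ℝ) :
    ∀ᵐ x ∂ν, ∃ (k k' : ℝ) (N : ℕ), 0 ≤ k ∧ C * k / (1 - κ) * κ ^ N ≤ 1 / 2 ∧
      ∀ s₀ : ℤ, ∃ s ≤ s₀, m x s ≤ k ∧ ∀ j < N, m x (s + (j : ℕ)) ≤ k' := by
  set T : (ℤ → E) → ℤ → E := fun x t => x (t - 1)
  -- Integer parameters leave only countably many events, hence one null set for all of them.
  let A : ℕ → ℕ → ℕ → Set (ℤ → E) := fun k k' N =>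
    {x | m x 0 ≤ k ∧ ∀ j < N, m x (j : ℕ) ≤ k'}
  have hA : ∀ k k' N, MeasurableSet (A k k' N) := by
    intro k k' N
    have : A k k' N = {x | m x 0 ≤ k} ∩ ⋂ j, ⋂ (_ : j < N), {x | m x (j : ℕ) ≤ k'} := by
      ext x
      simp [A]
    rw [this]
    exact (measurableSet_le (hm 0) measurable_const).inter (MeasurableSet.iInter fun j =>
      MeasurableSet.iInter fun _ => measurableSet_le (hm _) measurable_const)
  have hTm : ∀ x t, m (T x) t = m x (t - 1) := by
    intro x t
    have h := hms (T x) (t - 1)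
    have e : shift (T x) = x := by
      funext i
      simp [shift, T]
    rw [e, sub_add_cancel] at h
    exact h.symm
  have hTn : ∀ (n : ℕ) x t, m (T^[n] x) t = m x (t - n) := by
    intro n
    induction n with
    | zero => simp
    | succ n ih =>
      intro x t
      rw [Function.iterate_succ_apply', hTm, ih]
      congr 1
      push_cast
      ring
  have hrec : ∀ᵐ x ∂ν, ∀ k k' N : ℕ, x ∈ A k k' N → ∃ᶠ n in atTop, T^[n] x ∈ A k k' N := by
    simp only [ae_all_iff]
    exact fun k k' N => (measurePreserving_backward hν).conservative.ae_mem_imp_frequently_image_mem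
      (hA k k' N).nullMeasurableSet
  filter_upwards [hrec] with x hx
  -- The parameters are read off `x` itself: `k` from time `0`, then `N` from `k`, then `k'` from
  -- the window of length `N`. Thus `x` lies in its own event and returns to it.
  obtain ⟨k, hk⟩ := exists_nat_ge (m x 0)
  obtain ⟨N, hN⟩ : ∃ N : ℕ, C * k / (1 - κ) * κ ^ N ≤ 1 / 2 := by
    have : Tendsto (fun N : ℕ => C * k / (1 - κ) * κ ^ N) atTop (𝓝 (C * k / (1 - κ) * 0)) :=
      (tendsto_pow_atTop_nhds_zero_of_lt_one hκ₀ hκ₁).const_mul _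
    rw [mul_zero] at this
    exact (this.eventually_le_const (by norm_num)).exists
  obtain ⟨k', hk'⟩ : ∃ k' : ℕ, ∀ j < N, m x (j : ℕ) ≤ k' := by
    obtain ⟨b, hb⟩ := ((Finset.range N).image fun j : ℕ => m x j).bddAbove
    obtain ⟨k', hk'⟩ := exists_nat_ge b
    exact ⟨k', fun j hj => (hb (by
      simp only [Finset.coe_image, Set.mem_image, Finset.coe_range, Set.mem_Iio]
      exact ⟨j, hj, rfl⟩)).trans hk'⟩
  refine ⟨k, k', N, k.cast_nonneg, hN, fun s₀ => ?_⟩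
  obtain ⟨n, hn, hnA⟩ := (hx k k' N ⟨hk, hk'⟩).forall_exists_of_atTop s₀.natAbs
  refine ⟨-n, by omega, ?_, fun j hj => ?_⟩
  · have := hnA.1
    rwa [hTn, zero_sub] at this
  · have := hnA.2 j hj
    rw [hTn] at this
    rwa [neg_add_eq_sub]

/-- A stationary sequence with a logarithmic moment grows subexponentially. -/
lemma ae_isTame {E : Type*} [NormedAddCommGroup E] [MeasurableSpace E] [BorelSpace E]
    {ν : Measure (ℤ → E)} [IsProbabilityMeasure ν] (hν : MeasurePreserving shift ν ν)
    (hlog : Integrable (fun x : ℤ → E => Real.posLog ‖x 0‖) ν)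
    {κ : ℝ} (hκ₀ : 0 < κ) (hκ₁ : κ < 1) :
    ∀ᵐ x ∂ν, ∀ (c : ℝ) (w : ℤ → ℝ), (∀ t, |w t| ≤ c * ‖x t‖) → IsTame κ w := by
  have hlogκ : Real.log κ < 0 := Real.log_neg hκ₀ hκ₁
  -- With this `ε`, `κ * exp ε` is the square root of `κ`, so growth at rate `ε` is still summable
  -- against `κ ^ i`.
  set ε := -Real.log κ / 2 with hε
  have hε0 : 0 < ε := by rw [hε]; linarith
  have hr1 : κ * Real.exp ε < 1 := by
    rw [← Real.exp_log hκ₀, ← Real.exp_add, Real.exp_lt_one_iff, hε]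
    linarith
  have hpm : Measurable fun e : E => Real.posLog ‖e‖ :=
    (Real.continuous_posLog.comp continuous_norm).measurable
  have hsum : ∀ t : ℤ, ∀ᵐ x ∂ν, ∀ᶠ n : ℕ in atTop, Real.posLog ‖x (t - n)‖ ≤ ε * n := by
    intro t
    -- Integrability makes the tail probabilities of the logarithm at levels `ε * n` summable.
    -- Stationarity moves them to times `t - n`, and Borel–Cantelli applies.
    have h := @tsum_prob_mem_Ioi_lt_top _ ⟨ν⟩ ‹_› (fun x : ℤ → E => ε⁻¹ * Real.posLog ‖x 0‖)
      (hlog.const_mul _) fun x => mul_nonneg (inv_nonneg.2 hε0.le) Real.posLog_nonneg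
    have hU : ∀ n : ℕ, MeasurableSet {e : E | ε * n < Real.posLog ‖e‖} := fun n =>
      measurableSet_lt measurable_const hpm
    have e : ∀ n : ℕ, ν {x : ℤ → E | ε⁻¹ * Real.posLog ‖x 0‖ ∈ Set.Ioi (n : ℝ)}
        = ν {x : ℤ → E | ε * n < Real.posLog ‖x (t - n)‖} := by
      intro n
      have h1 := congrArg (fun μ => μ {e : E | ε * n < Real.posLog ‖e‖})
        (map_eq_of_invariant hν (m := fun x => x) measurable_pi_apply (fun _ _ => rfl) (t - n))
      rw [Measure.map_apply (measurable_pi_apply _) (hU n),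
        Measure.map_apply (measurable_pi_apply _) (hU n)] at h1
      refine Eq.trans ?_ h1.symm
      congr 1
      ext x
      simp only [Set.mem_Ioi, Set.mem_ofPred_eq, Set.preimage_ofPred_eq]
      rw [lt_inv_mul_iff₀ hε0]
    have h2 : (∑' n : ℕ, ν {x : ℤ → E | ε * n < Real.posLog ‖x (t - n)‖}) ≠ ⊤ := by
      simp only [← e]
      exact h.ne
    filter_upwards [ae_eventually_notMem h2] with x hx
    filter_upwards [hx] with n hn
    simpa using hn
  filter_upwards [ae_all_iff.2 hsum] with x hx c w hw t
  have hsummable : Summable fun n : ℕ => |c| * (κ * Real.exp ε) ^ n :=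
    (summable_geometric_of_lt_one (by positivity) hr1).mul_left _
  refine hsummable.of_norm_bounded_eventually_nat ?_
  filter_upwards [hx t] with n hn
  have hxn : ‖x (t - n)‖ ≤ Real.exp (ε * n) := by
    rcases (norm_nonneg (x (t - n))).eq_or_lt with h0 | h0
    · rw [← h0]
      positivity
    · rw [← Real.log_le_iff_le_exp h0]
      exact (le_max_right _ _).trans hn
  rw [Real.norm_eq_abs, abs_mul, abs_of_nonneg (by positivity : 0 ≤ κ ^ n), abs_abs]
  calc κ ^ n * |w (t - n)| ≤ κ ^ n * (|c| * Real.exp (ε * n)) := by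
        gcongr
        refine (hw _).trans ?_
        gcongr
        exact le_abs_self c
    _ = |c| * (κ * Real.exp ε) ^ n := by
        rw [mul_pow, ← Real.exp_nat_mul, mul_comm (n : ℝ) ε]
        ring

end Environment

end BinaryAR

/-! ### Shift invariance and ergodicity of the Gibbs law -/

namespace BinaryAR

variable {S : Type*} {p : S → ℤ → (ℤ → Fin 2) → ℝ} {θ : S → S}

/-- The specification commutes with the transformation `θ` of the environment and the shift of the
binary sequence. -/
def IsEquivariant (p : S → ℤ → (ℤ → Fin 2) → ℝ) (θ : S → S) : Prop :=
  ∀ x s y, p (θ x) s (shift y) = p x (s + 1) y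

lemma shift_update (s : ℤ) (y : ℤ → Fin 2) (a : Fin 2) :
    shift (Function.update y (s + 1) a) = Function.update (shift y) s a := by
  funext i
  rcases eq_or_ne i s with rfl | hne
  · simp [shift]
  · have : i + 1 ≠ s + 1 := by omega
    simp [shift, hne]

lemma IsEquivariant.transfer_shift (hθ : IsEquivariant p θ) (x : S) (s : ℤ)
    (f : (ℤ → Fin 2) → ℝ) (y : ℤ → Fin 2) :
    transfer (p x (s + 1)) (s + 1) (fun z => f (shift z)) y
      = transfer (p (θ x) s) s f (shift y) := by
  simp only [transfer, shift_update, hθ x s y]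

variable [MeasurableSpace S]

lemma DependsOn.comp_shift {β : Type*} {f : (ℤ → Fin 2) → β} {s : ℤ}
    (hf : DependsOn f (Set.Iic s)) : DependsOn (fun y => f (shift y)) (Set.Iic (s + 1)) :=
  fun _ _ h => hf fun i hi => h (i + 1) (Set.mem_Iic.2 (by have := Set.mem_Iic.1 hi; omega))

lemma measurable_prodMap_shift (hθm : Measurable θ) :
    Measurable (Prod.map θ (shift : (ℤ → Fin 2) → ℤ → Fin 2)) :=
  (hθm.comp measurable_fst).prodMk (measurable_shift.comp measurable_snd)

lemma measurable_transfer_uncurry (hp : IsSpecification p) {f : S → (ℤ → Fin 2) → ℝ}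
    (hf : Measurable (Function.uncurry f)) (s : ℤ) :
    Measurable fun z : S × (ℤ → Fin 2) => transfer (p z.1 s) s (f z.1) z.2 :=
  measurable_transfer (q := fun x => p x s) (hp.measurable s) hf

lemma IsGibbs.map_shift (hp : IsSpecification p) (hθ : IsEquivariant p θ) (hθm : Measurable θ)
    {ρ : Measure (S × (ℤ → Fin 2))} (hρ : IsGibbs p ρ) :
    IsGibbs p (ρ.map (Prod.map θ shift)) := by
  rintro s f hf ⟨C, hC⟩ hd
  have hσ := measurable_prodMap_shift hθm
  rw [integral_map hσ.aemeasurable (by exact hf.aestronglyMeasurable),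
    integral_map hσ.aemeasurable (measurable_transfer_uncurry hp hf s).aestronglyMeasurable]
  have := hρ (s + 1) (fun x y => f (θ x) (shift y)) (hf.comp hσ) ⟨C, fun x y => hC _ _⟩
    fun x => DependsOn.comp_shift (hd (θ x))
  simp only [hθ.transfer_shift] at this
  exact this

lemma IsGibbs.smul {ρ : Measure (S × (ℤ → Fin 2))} (hρ : IsGibbs p ρ) (c : ENNReal) :
    IsGibbs p (c • ρ) := by
  intro s f hf hC hd
  rw [integral_smul_measure, integral_smul_measure, hρ s f hf hC hd]

/-- Events of `S × {0,1}^ℤ` that depend on the environment and on the past of the binary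
sequence at some time. -/
def pastEvents (S : Type*) [MeasurableSpace S] : Set (Set (S × (ℤ → Fin 2))) :=
  {C | MeasurableSet C ∧ ∃ m : ℤ, ∀ x, DependsOn (fun y => (x, y) ∈ C) (Set.Iio m)}

/-- These events form a generating algebra, so every event is approximated in measure by one that
looks at the responses only up to a finite time. -/
lemma isSetAlgebra_pastEvents : IsSetAlgebra (pastEvents S) where
  empty_mem := ⟨MeasurableSet.empty, 0, fun x y y' _ => by simp⟩
  compl_mem := by
    rintro C ⟨hC, m, hm⟩
    refine ⟨hC.compl, m, fun x y y' h => ?_⟩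
    have := hm x h
    simp only [Set.mem_compl_iff] at this ⊢
    rw [this]
  union_mem := by
    rintro C D ⟨hC, m, hm⟩ ⟨hD, n, hn⟩
    refine ⟨hC.union hD, max m n, fun x y y' h => ?_⟩
    have h1 := hm x fun i hi => h i (Set.mem_Iio.2 (lt_max_of_lt_left hi))
    have h2 := hn x fun i hi => h i (Set.mem_Iio.2 (lt_max_of_lt_right hi))
    simp only [Set.mem_union] at h1 h2 ⊢
    rw [h1, h2]

lemma generateFrom_pastEvents :
    (inferInstance : MeasurableSpace (S × (ℤ → Fin 2)))
      = MeasurableSpace.generateFrom (pastEvents S) := by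
  refine le_antisymm ?_ (MeasurableSpace.generateFrom_le fun C hC => hC.1)
  refine sup_le ?_ ?_
  · rintro _ ⟨B, hB, rfl⟩
    exact MeasurableSpace.measurableSet_generateFrom
      ⟨measurable_fst hB, 0, fun x y y' _ => rfl⟩
  · change MeasurableSpace.comap _ (⨆ i, MeasurableSpace.comap (fun y : ℤ → Fin 2 => y i) _) ≤ _
    rw [MeasurableSpace.comap_iSup]
    refine iSup_le fun i => ?_
    rw [MeasurableSpace.comap_comp]
    rintro _ ⟨B, hB, rfl⟩
    refine MeasurableSpace.measurableSet_generateFrom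
      ⟨((measurable_pi_apply i).comp measurable_snd) hB, i + 1, fun x y y' h => ?_⟩
    have : y i = y' i := h i (Set.mem_Iio.2 (by omega))
    simp [this]

lemma abs_setIntegral_sub_le {Ω : Type*} [MeasurableSpace Ω] {μ : Measure Ω} [IsFiniteMeasure μ]
    {A B : Set Ω} (hA : MeasurableSet A) (hB : MeasurableSet B) {u : Ω → ℝ} (hu : Measurable u)
    {C : ℝ} (hC : ∀ z, |u z| ≤ C) :
    |∫ z in A, u z ∂μ - ∫ z in B, u z ∂μ| ≤ C * μ.real (symmDiff A B) := by
  have hi : Integrable u μ := Integrable.of_bound hu.aestronglyMeasurable C (.of_forall hC)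
  rw [← integral_indicator hA, ← integral_indicator hB,
    ← integral_sub (hi.indicator hA) (hi.indicator hB)]
  have hs : MeasurableSet (symmDiff A B) := (hA.diff hB).union (hB.diff hA)
  have e : ∀ z, A.indicator u z - B.indicator u z
      = (symmDiff A B).indicator (fun z => A.indicator u z - B.indicator u z) z := by
    intro z
    by_cases ha : z ∈ A <;> by_cases hb : z ∈ B <;> simp [ha, hb, Set.mem_symmDiff, Set.indicator]
  rw [integral_congr_ae (.of_forall e), integral_indicator hs, ← Real.norm_eq_abs]
  refine norm_setIntegral_le_of_norm_le_const_ae (measure_lt_top _ _) (.of_forall fun z => ?_)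
  rw [Real.norm_eq_abs]
  by_cases ha : z ∈ A <;> by_cases hb : z ∈ B
  · simpa [ha, hb] using (abs_nonneg _).trans (hC z)
  · simpa [ha, hb] using hC z
  · simpa [ha, hb] using hC z
  · simpa [ha, hb] using (abs_nonneg _).trans (hC z)

/-- The indicator of an event of the strict past is a known factor and pulls out of the transfer. -/
lemma IsGibbs.setIntegral_eq {ρ : Measure (S × (ℤ → Fin 2))} (hρ : IsGibbs p ρ)
    {C : Set (S × (ℤ → Fin 2))} (hC : MeasurableSet C) {s : ℤ}
    (hCd : ∀ x, DependsOn (fun y => (x, y) ∈ C) (Set.Iio s))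
    {f : S → (ℤ → Fin 2) → ℝ} (hf : Measurable (Function.uncurry f))
    (hb : ∃ b, ∀ x y, |f x y| ≤ b) (hd : ∀ x, DependsOn (f x) (Set.Iic s)) :
    ∫ z in C, f z.1 z.2 ∂ρ = ∫ z in C, transfer (p z.1 s) s (f z.1) z.2 ∂ρ := by
  rw [← integral_indicator hC, ← integral_indicator hC]
  have hI : ∀ x, DependsOn (fun y => C.indicator (1 : S × (ℤ → Fin 2) → ℝ) (x, y))
      (Set.Iio s) := by
    intro x y y' h
    have := hCd x h
    simp only [eq_iff_iff] at this
    by_cases hy : (x, y) ∈ C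
    · simp [hy, this.1 hy]
    · simp [hy, this.not.1 hy]
  have e : ∀ (u : S × (ℤ → Fin 2) → ℝ) z, C.indicator u z
      = C.indicator (1 : S × (ℤ → Fin 2) → ℝ) (z.1, z.2) * u z := by
    intro u z
    by_cases hz : z ∈ C <;> simp [hz]
  rw [integral_congr_ae (.of_forall (e fun z => f z.1 z.2)),
    integral_congr_ae (.of_forall (e fun z => transfer (p z.1 s) s (f z.1) z.2))]
  obtain ⟨b, hb⟩ := hb
  have h0 := hρ s (fun x y => C.indicator (1 : S × (ℤ → Fin 2) → ℝ) (x, y) * f x y)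
    ((measurable_one.indicator hC).mul hf) ⟨b, fun x y => ?_⟩ fun x y y' h => ?_
  · rw [h0]
    refine integral_congr_ae (.of_forall fun z => ?_)
    exact congrFun (transfer_mul_left (q := p z.1 s) (h := f z.1) (hI z.1)) z.2
  · by_cases hz : (x, y) ∈ C
    · simpa [hz] using hb x y
    · simpa [hz] using (abs_nonneg _).trans (hb x y)
  · have h1 := hI x fun i (hi : i < s) => h i (le_of_lt hi)
    simp only at h1 ⊢
    rw [h1, hd x h]

/-- Conditioning on an invariant event does not change the conditional probabilities. -/
lemma IsGibbs.restrict_invariant (hp : IsSpecification p) (hθ : IsEquivariant p θ)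
    {ρ : Measure (S × (ℤ → Fin 2))} [IsFiniteMeasure ρ] (hρ : IsGibbs p ρ)
    (hinv : MeasurePreserving (Prod.map θ shift) ρ ρ) {A : Set (S × (ℤ → Fin 2))}
    (hA : MeasurableSet A) (hAi : Prod.map θ shift ⁻¹' A = A) : IsGibbs p (ρ.restrict A) := by
  set σ : S × (ℤ → Fin 2) → S × (ℤ → Fin 2) := Prod.map θ shift with hσ
  have hinvA : MeasurePreserving σ (ρ.restrict A) (ρ.restrict A) := by
    have := hinv.restrict_preimage hA
    rwa [hAi] at this
  rintro s f hf ⟨b, hb⟩ hd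
  -- By invariance of `A`, translating the test function to time `s + j` changes neither integral
  -- over `A`.
  have shifted : ∀ j : ℕ, ∃ u : S → (ℤ → Fin 2) → ℝ, Measurable (Function.uncurry u) ∧
      (∀ x y, |u x y| ≤ b) ∧ (∀ x, DependsOn (u x) (Set.Iic (s + j))) ∧
      ∫ z, u z.1 z.2 ∂(ρ.restrict A) = ∫ z, f z.1 z.2 ∂(ρ.restrict A) ∧
      ∫ z, transfer (p z.1 (s + j)) (s + j) (u z.1) z.2 ∂(ρ.restrict A)
        = ∫ z, transfer (p z.1 s) s (f z.1) z.2 ∂(ρ.restrict A) := by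
    intro j
    induction j with
    | zero => exact ⟨f, hf, hb, by simpa using hd, rfl, by simp⟩
    | succ j ih =>
      obtain ⟨u, hu, hub, hud, h1, h2⟩ := ih
      have e : s + ((j + 1 : ℕ) : ℤ) = s + j + 1 := by push_cast; ring
      rw [e]
      refine ⟨fun x y => u (θ x) (shift y), hu.comp hinv.measurable, fun x y => hub _ _,
        fun x => DependsOn.comp_shift (hud _), ?_, ?_⟩
      · rw [← h1]
        conv_rhs => rw [← hinvA.map_eq]
        exact (integral_map hinv.measurable.aemeasurable
          (by exact hu.aestronglyMeasurable)).symm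
      · simp only [hθ.transfer_shift]
        rw [← h2]
        conv_rhs => rw [← hinvA.map_eq]
        exact (integral_map hinv.measurable.aemeasurable
          (measurable_transfer_uncurry hp hu (s + j)).aestronglyMeasurable).symm
  -- Only over an empty environment can the bound `b` be negative.
  have b0 : 0 ≤ b ∨ IsEmpty S := by
    rcases isEmpty_or_nonempty S with h | ⟨⟨x⟩⟩
    · exact .inr h
    · exact .inl ((abs_nonneg _).trans (hb x 0))
  rcases b0 with b0 | hS
  swap
  · have : IsEmpty (S × (ℤ → Fin 2)) := ⟨fun z => hS.false z.1⟩
    simp [Measure.eq_zero_of_isEmpty]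
  refine eq_of_abs_sub_le_all fun ε hε => ?_
  -- Replacing `A` by `C` costs at most `ε / 2` in each of the two integrals; the `+ 1` covers `b =
  -- 0`.
  obtain ⟨C, ⟨hC, m, hm⟩, hAC⟩ := (Measure.MeasureDense.of_generateFrom_isSetAlgebra_finite ρ
    isSetAlgebra_pastEvents generateFrom_pastEvents).approx A hA (measure_ne_top _ _)
    (ε / (2 * (b + 1))) (by positivity)
  have hreal : ρ.real (symmDiff A C) ≤ ε / (2 * (b + 1)) := by
    have := ENNReal.toReal_mono ENNReal.ofReal_ne_top hAC.le
    rwa [ENNReal.toReal_ofReal (by positivity)] at this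
  -- After this translation `C` is an event of the strict past of the test time, where the Gibbs
  -- identity holds on `C`.
  obtain ⟨u, hu, hub, hud, h1, h2⟩ := shifted (m - s).toNat
  have hms : m ≤ s + (m - s).toNat := by omega
  set r := s + ((m - s).toNat : ℤ)
  rw [← h1, ← h2]
  have hCe := hρ.setIntegral_eq hC (s := r) (fun x => (hm x).mono (Set.Iio_subset_Iio hms)) hu
    ⟨b, hub⟩ hud
  have e1 := abs_setIntegral_sub_le (μ := ρ) hA hC (u := fun z => u z.1 z.2) hu
    fun z => hub z.1 z.2
  have e2 := abs_setIntegral_sub_le (μ := ρ) hA hC (measurable_transfer_uncurry hp hu r)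
    fun z => abs_transfer_le (hp.mem_Icc z.1 r) (hub z.1) z.2
  have hbε : b * ρ.real (symmDiff A C) ≤ ε / 2 := by
    calc b * ρ.real (symmDiff A C) ≤ (b + 1) * (ε / (2 * (b + 1))) := by
          gcongr
          linarith
      _ = ε / 2 := by field_simp
  rw [hCe] at e1
  rw [abs_le] at e1 e2 ⊢
  constructor <;> linarith [e1.1, e1.2, e2.1, e2.2]

/-- The joint law of the environment and the binary sequence is invariant. -/
theorem IsGibbs.measurePreserving (hp : IsSpecification p) (hθ : IsEquivariant p θ)
    {ρ : Measure (S × (ℤ → Fin 2))} [IsFiniteMeasure ρ] (hρ : IsGibbs p ρ)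
    (hF : ∀ᵐ x ∂(ρ.map Prod.fst), Forgets (p x))
    (hinv : MeasurePreserving θ (ρ.map Prod.fst) (ρ.map Prod.fst)) :
    MeasurePreserving (Prod.map θ shift) ρ ρ := by
  have hσ := measurable_prodMap_shift (S := S) hinv.measurable
  -- The shifted law is again Gibbs with the same environment marginal, so uniqueness applies.
  refine ⟨hσ, hρ.eq_of_map_fst_eq hp (hρ.map_shift hp hθ hinv.measurable) hF ?_⟩
  rw [Measure.map_map measurable_fst hσ]
  conv_rhs => rw [← hinv.map_eq]
  rw [Measure.map_map hinv.measurable measurable_fst]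
  rfl

/-- The joint law of the environment and the binary sequence is ergodic. -/
theorem IsGibbs.ergodic (hp : IsSpecification p) (hθ : IsEquivariant p θ)
    {ρ : Measure (S × (ℤ → Fin 2))} [IsFiniteMeasure ρ] (hρ : IsGibbs p ρ)
    (hF : ∀ᵐ x ∂(ρ.map Prod.fst), Forgets (p x)) (herg : Ergodic θ (ρ.map Prod.fst)) :
    Ergodic (Prod.map θ shift) ρ := by
  have hinv := hρ.measurePreserving hp hθ hF herg.toMeasurePreserving
  refine ⟨hinv, ⟨fun A hA hAi => ?_⟩⟩
  have hG := hρ.restrict_invariant hp hθ hinv hA hAi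
  have hinvA : MeasurePreserving (Prod.map θ shift) (ρ.restrict A) (ρ.restrict A) := by
    have := hinv.restrict_preimage hA
    rwa [hAi] at this
  have hfst : MeasurePreserving θ ((ρ.restrict A).map Prod.fst) ((ρ.restrict A).map Prod.fst) := by
    refine ⟨herg.measurable, ?_⟩
    conv_rhs => rw [← hinvA.map_eq]
    rw [Measure.map_map herg.measurable measurable_fst,
      Measure.map_map measurable_fst hinv.measurable]
    rfl
  -- An invariant measure absolutely continuous with respect to an ergodic one is a multiple of it.
  obtain ⟨c, hc⟩ := herg.eq_smul_of_absolutelyContinuous hfst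
    (Measure.restrict_le_self.absolutelyContinuous.map measurable_fst)
  rw [eventuallyConst_set']
  rcases eq_or_ne ρ 0 with rfl | hρ0
  · simp
  have hctop : c ≠ ⊤ := by
    rintro rfl
    have h1 := congrArg (fun μ => μ Set.univ) hc
    simp only [Measure.smul_apply, smul_eq_mul] at h1
    rw [Measure.map_apply measurable_fst .univ, Measure.map_apply measurable_fst .univ] at h1
    simp only [Set.preimage_univ] at h1
    rw [ENNReal.top_mul (by simpa using hρ0)] at h1
    exact measure_ne_top _ _ h1
  have : IsFiniteMeasure (c • ρ) := ρ.smul_finite hctop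
  -- Both sides are Gibbs with the same marginal. Evaluating on `Aᶜ` then forces `c = 0` or `ρ Aᶜ =
  -- 0`.
  have heq : ρ.restrict A = c • ρ := by
    refine (hρ.smul c).eq_of_map_fst_eq hp hG ?_ ?_
    · rw [Measure.map_smul]
      exact Measure.ae_smul_measure hF c
    · rw [hc, Measure.map_smul]
  have h0 : c * ρ Aᶜ = 0 := by
    have := congrArg (fun μ => μ Aᶜ) heq
    simp only [Measure.smul_apply, smul_eq_mul] at this
    rw [← this, Measure.restrict_apply hA.compl]
    simp
  rcases mul_eq_zero.1 h0 with rfl | h0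
  · left
    rw [zero_smul, Measure.restrict_eq_zero] at heq
    exact ae_eq_empty.2 heq
  · right
    exact eventuallyEq_univ.2 (mem_ae_iff.2 h0)

end BinaryAR

/-! ### Solutions of the model and Gibbs laws -/

namespace BinaryAR

/-- The standing assumptions on the link function `F` and the autoregression function `g`. -/
structure IsModel (F g : ℝ → ℝ) (κ : ℝ) : Prop where
  monotone : Monotone F
  pos : ∀ s, 0 < F s
  le_one : ∀ s, F s ≤ 1
  lipschitz : ∃ K, LipschitzWith K F
  rate_pos : 0 < κ
  rate_lt_one : κ < 1
  contraction : ∀ s s' : ℝ, |g s - g s'| ≤ κ * |s - s'|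

variable {d : ℕ} {F g : ℝ → ℝ} {κ α : ℝ} {γ : EuclideanSpace ℝ (Fin d)}

lemma IsModel.continuous_link (h : IsModel F g κ) : Continuous F :=
  h.lipschitz.choose_spec.continuous

lemma IsModel.mem_Icc (h : IsModel F g κ) (s : ℝ) : F s ∈ Set.Icc (0 : ℝ) 1 :=
  ⟨(h.pos s).le, h.le_one s⟩

/-- The contribution of the covariates to the recursion of the latent process. -/
noncomputable def input (γ : EuclideanSpace ℝ (Fin d)) (x : ℤ → EuclideanSpace ℝ (Fin d)) :
    ℤ → ℝ := fun t => inner ℝ γ (x t)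

lemma measurable_input (γ : EuclideanSpace ℝ (Fin d)) : Measurable (input γ) := by
  refine measurable_pi_lambda _ fun t => ?_
  exact (continuous_const.inner continuous_id).measurable.comp (measurable_pi_apply t)

/-- The conditional probability of a success given the covariates and the past. -/
noncomputable def response (F g : ℝ → ℝ) (α : ℝ) (γ : EuclideanSpace ℝ (Fin d))
    (x : ℤ → EuclideanSpace ℝ (Fin d)) (t : ℤ) (y : ℤ → Fin 2) : ℝ :=
  F (latent g α (input γ x) t y)

lemma IsModel.measurable_latent_input (h : IsModel F g κ) (α : ℝ)
    (γ : EuclideanSpace ℝ (Fin d)) (t : ℤ) :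
    Measurable fun z : (ℤ → EuclideanSpace ℝ (Fin d)) × (ℤ → Fin 2) =>
      latent g α (input γ z.1) t z.2 :=
  measurable_latent (continuous_of_contraction h.contraction).measurable
    ((measurable_input γ).comp measurable_fst) measurable_snd α t

lemma IsModel.isSpecification (h : IsModel F g κ) (α : ℝ) (γ : EuclideanSpace ℝ (Fin d)) :
    IsSpecification (response F g α γ) where
  mem_Icc _ _ _ := h.mem_Icc _
  measurable s := h.continuous_link.measurable.comp (h.measurable_latent_input α γ s)
  dependsOn x s y y' hy := by simp only [response, dependsOn_latent s hy]

lemma isEquivariant_response : IsEquivariant (response F g α γ) shift := fun x s y => by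
  change F (latent g α (shift (input γ x)) s (shift y)) = _
  rw [latent_shift]
  rfl

lemma IsModel.ae_isTame (h : IsModel F g κ) (γ : EuclideanSpace ℝ (Fin d))
    {ν : Measure (ℤ → EuclideanSpace ℝ (Fin d))}
    [IsProbabilityMeasure ν] (hν : MeasurePreserving shift ν ν)
    (hlog : Integrable (fun x : ℤ → EuclideanSpace ℝ (Fin d) => Real.posLog ‖x 0‖) ν) :
    ∀ᵐ x ∂ν, IsTame κ (input γ x) := by
  filter_upwards [BinaryAR.ae_isTame hν hlog h.rate_pos h.rate_lt_one] with x hx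
  exact hx ‖γ‖ _ fun t => abs_real_inner_le_norm γ (x t)

lemma IsModel.ae_forgets (h : IsModel F g κ) (α : ℝ) (γ : EuclideanSpace ℝ (Fin d))
    {ν : Measure (ℤ → EuclideanSpace ℝ (Fin d))}
    [IsProbabilityMeasure ν] (hν : MeasurePreserving shift ν ν)
    (hlog : Integrable (fun x : ℤ → EuclideanSpace ℝ (Fin d) => Real.posLog ‖x 0‖) ν) :
    ∀ᵐ x ∂ν, Forgets (response F g α γ x) := by
  obtain ⟨K, hK⟩ := h.lipschitz
  have hrec := ae_recurrent hν (m := fun x => discounted κ (|g 0| + |α|) (input γ x))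
    (fun t => (measurable_discounted _ _ t).comp (measurable_input γ))
    (fun x t => discounted_shift _ _ (input γ x) t) h.rate_pos.le h.rate_lt_one (2 * K)
  filter_upwards [h.ae_isTame γ hν hlog, hrec] with x hx ⟨k, k', N, hk, hN, hs⟩
  exact hx.forgets h.monotone h.pos h.le_one hK h.rate_pos h.rate_lt_one h.contraction hk hN hs

section Paths

variable {Ω S : Type*}

/-- The trajectories of the covariates and of the binary responses. -/
def paths (X : ℤ → Ω → S) (Y : ℤ → Ω → Fin 2) (ω : Ω) : (ℤ → S) × (ℤ → Fin 2) :=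
  (fun t => X t ω, fun t => Y t ω)

lemma isOne_paths_eq_indicator (X : ℤ → Ω → S) (Y : ℤ → Ω → Fin 2) (t : ℤ) :
    (fun ω => isOne t (paths X Y ω).2) = (Y t ⁻¹' {1}).indicator (fun _ => (1 : ℝ)) := by
  funext ω
  by_cases h : Y t ω = 1
  · simp [isOne, paths, h]
  · have : Y t ω = 0 := by omega
    simp [isOne, paths, this]

/-- The trajectories of the covariates and of the responses before time `t`. -/
def pastPaths (X : ℤ → Ω → S) (Y : ℤ → Ω → Fin 2) (t : ℤ) (ω : Ω) : (ℤ → S) × (ℤ → Fin 2) :=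
  (fun t => X t ω, past t fun t => Y t ω)

variable [MeasurableSpace S]

/-- One map generates the conditioning σ-algebra, so its events and measurable functions can be
expressed through the trajectory of `X` and the past of `Y`. -/
lemma info_eq_comap (X : ℤ → Ω → S) (Y : ℤ → Ω → Fin 2) (t : ℤ) :
    info X Y t = MeasurableSpace.comap (pastPaths X Y t) inferInstance := by
  apply le_antisymm
  · have hm := comap_measurable (m := (inferInstance : MeasurableSpace ((ℤ → S) × (ℤ → Fin 2))))
      (pastPaths X Y t)
    refine sup_le (iSup_le fun s => ?_) (iSup_le fun s => ?_)
    · have h1 := (measurable_pi_apply (s : ℤ)).comp (measurable_snd.comp hm)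
      have e : (fun y : ℤ → Fin 2 => y s) ∘ Prod.snd ∘ pastPaths X Y t = Y s := by
        funext ω
        exact past_apply_of_lt s.2 fun r => Y r ω
      rw [e] at h1
      exact h1.comap_le
    · exact ((measurable_pi_apply s).comp (measurable_fst.comp hm)).comap_le
  · have hX : ∀ s, Measurable[info X Y t] (X s) := fun s =>
      (comap_measurable (X s)).mono (le_sup_of_le_right
        (le_iSup (fun s : ℤ => MeasurableSpace.comap (X s) inferInstance) s)) le_rfl
    have hY : ∀ s < t, Measurable[info X Y t] (Y s) := fun s hs =>
      (comap_measurable (Y s)).mono (le_sup_of_le_left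
        (le_iSup (fun s : {s : ℤ // s < t} => MeasurableSpace.comap (Y s) inferInstance)
          ⟨s, hs⟩)) le_rfl
    refine measurable_iff_comap_le.1 ?_
    let _ : MeasurableSpace Ω := info X Y t
    refine Measurable.prodMk (measurable_pi_lambda _ hX)
      (measurable_pi_lambda _ fun s => ?_)
    by_cases hs : s < t
    · simpa [past, hs] using hY s hs
    · simp only [past, hs, if_false]
      exact measurable_const

lemma measurable_comp_paths {X : ℤ → Ω → S} {Y : ℤ → Ω → Fin 2} {t : ℤ}
    {f : (ℤ → S) → (ℤ → Fin 2) → ℝ} (hf : Measurable (Function.uncurry f))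
    (hd : ∀ x, DependsOn (f x) (Set.Iio t)) :
    Measurable[info X Y t] fun ω => f (paths X Y ω).1 (paths X Y ω).2 := by
  have e : (fun ω => f (paths X Y ω).1 (paths X Y ω).2)
      = Function.uncurry f ∘ pastPaths X Y t := by
    funext ω
    exact (DependsOn.comp_past (hd _) _).symm
  rw [e, info_eq_comap]
  exact hf.comp (comap_measurable _)

variable [MeasurableSpace Ω]

lemma measurable_paths {X : ℤ → Ω → S} {Y : ℤ → Ω → Fin 2} (hX : ∀ t, Measurable (X t))
    (hY : ∀ t, Measurable (Y t)) : Measurable (paths X Y) :=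
  (measurable_pi_lambda _ hX).prodMk (measurable_pi_lambda _ hY)

lemma info_le {X : ℤ → Ω → S} {Y : ℤ → Ω → Fin 2} (hX : ∀ t, Measurable (X t))
    (hY : ∀ t, Measurable (Y t)) (t : ℤ) : info X Y t ≤ (inferInstance : MeasurableSpace Ω) :=
  sup_le (iSup_le fun s => (hY s).comap_le) (iSup_le fun s => (hX s).comap_le)

end Paths

section Solution

variable {Ω : Type*} [MeasurableSpace Ω] {P : Measure Ω}
  {X : ℤ → Ω → EuclideanSpace ℝ (Fin d)} {Y : ℤ → Ω → Fin 2} {lam : ℤ → Ω → ℝ}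

/-- The distance to the latent process started from the remote past decreases geometrically. -/
lemma IsSolution.ae_abs_sub_latent_le (h : IsSolution F g α γ P X Y lam) (hM : IsModel F g κ)
    (hT : ∀ᵐ ω ∂P, IsTame κ (input γ fun t => X t ω)) :
    ∀ᵐ ω ∂P, ∀ (s : ℤ) (n : ℕ),
      |lam (s + n) ω - latent g α (input γ (paths X Y ω).1) (s + n) (paths X Y ω).2|
        ≤ κ ^ n * |lam s ω - latent g α (input γ (paths X Y ω).1) s (paths X Y ω).2| := by
  filter_upwards [hT, ae_all_iff.2 h.recursion] with ω hω hrec s n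
  refine abs_sub_le_pow_mul hM.rate_pos.le hM.contraction (a := fun t => lam t ω)
    (b := fun t => latent g α (input γ (paths X Y ω).1) t (paths X Y ω).2)
    (v := fun t => α * ((Y (t - 1) ω : ℕ) : ℝ) + inner ℝ γ (X t ω)) n fun t _ _ => ⟨?_, ?_⟩
  · rw [hrec t, add_assoc]
  · have := hω.latent_eq (α := α) hM.rate_pos.le hM.rate_lt_one hM.contraction
      (paths X Y ω).2 t
    exact this.trans (add_assoc _ _ _)

variable [IsProbabilityMeasure P]

/-- The conditional probabilities of a solution, tested against functions of the past. -/
lemma IsSolution.integral_mul_isOne (h : IsSolution F g α γ P X Y lam) (t : ℤ)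
    {f : (ℤ → EuclideanSpace ℝ (Fin d)) → (ℤ → Fin 2) → ℝ}
    (hf : Measurable (Function.uncurry f)) {b : ℝ} (hb : ∀ x y, |f x y| ≤ b)
    (hd : ∀ x, DependsOn (f x) (Set.Iio t)) :
    ∫ ω, f (paths X Y ω).1 (paths X Y ω).2 * isOne t (paths X Y ω).2 ∂P
      = ∫ ω, f (paths X Y ω).1 (paths X Y ω).2 * F (lam t ω) ∂P := by
  have hm := info_le h.measurable_X h.measurable_Y t
  have hZ := measurable_paths h.measurable_X h.measurable_Y
  have hint : Integrable (fun ω => isOne t (paths X Y ω).2) P :=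
    Integrable.of_bound ((measurable_isOne t).comp (measurable_snd.comp hZ)).aestronglyMeasurable 1
      (.of_forall fun ω => by
        have := isOne_mem_Icc t (paths X Y ω).2
        rw [Real.norm_eq_abs, abs_of_nonneg this.1]
        exact this.2)
  have hpull := condExp_stronglyMeasurable_mul_of_bound hm
    (measurable_comp_paths (X := X) (Y := Y) hf hd).stronglyMeasurable hint b
    (.of_forall fun ω => hb _ _)
  have hcond := h.cond_prob t
  rw [← isOne_paths_eq_indicator X Y t] at hcond
  have e1 := integral_condExp hm
    (f := (fun ω => f (paths X Y ω).1 (paths X Y ω).2) * fun ω => isOne t (paths X Y ω).2)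
    (μ := P)
  simp only [Pi.mul_apply] at e1
  rw [← e1]
  refine integral_congr_ae ?_
  filter_upwards [hpull, hcond] with ω h1 h2
  rw [h1, Pi.mul_apply, h2]

/-- A process with the prescribed conditional probabilities, together with its latent process
started from the remote past, is a solution. -/
lemma isSolution_of_isGibbs (hM : IsModel F g κ) (hX : ∀ t, Measurable (X t))
    (hY : ∀ t, Measurable (Y t)) (hG : IsGibbs (response F g α γ) (P.map (paths X Y)))
    (hT : ∀ᵐ ω ∂P, IsTame κ (input γ fun t => X t ω)) :
    IsSolution F g α γ P X Y
      (fun t ω => latent g α (input γ (paths X Y ω).1) t (paths X Y ω).2) := by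
  have hZ := measurable_paths hX hY
  have hlat := fun t => hM.measurable_latent_input α γ t
  have hres := fun t => (hM.isSpecification α γ).measurable t
  refine ⟨hX, hY, fun t => (hlat t).comp hZ, fun t => ?_, fun t => ?_⟩
  · have hm := info_le hX hY t
    rw [← isOne_paths_eq_indicator X Y t]
    have hbound : ∀ ω, ‖response F g α γ (paths X Y ω).1 t (paths X Y ω).2‖ ≤ 1 := fun ω => by
      have := (hM.isSpecification α γ).mem_Icc (paths X Y ω).1 t (paths X Y ω).2
      rw [Real.norm_eq_abs, abs_of_nonneg this.1]
      exact this.2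
    have hint : Integrable (fun ω => isOne t (paths X Y ω).2) P :=
      Integrable.of_bound
        ((measurable_isOne t).comp (measurable_snd.comp hZ)).aestronglyMeasurable 1
        (.of_forall fun ω => by
          have := isOne_mem_Icc t (paths X Y ω).2
          rw [Real.norm_eq_abs, abs_of_nonneg this.1]
          exact this.2)
    refine (ae_eq_condExp_of_forall_setIntegral_eq hm hint
      (g := fun ω => response F g α γ (paths X Y ω).1 t (paths X Y ω).2)
      (fun s _ _ => (Integrable.of_bound ((hres t).comp hZ).aestronglyMeasurable 1
        (.of_forall hbound)).integrableOn) (fun s hs _ => ?_) ?_).symm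
    · have hs' := hm s hs
      rw [info_eq_comap] at hs
      -- An event of the conditioning σ-algebra becomes a test function of the environment and the
      -- strict past, to which the Gibbs identity applies.
      obtain ⟨B, hB, rfl⟩ := hs
      have hf : Measurable (Function.uncurry fun (x : ℤ → EuclideanSpace ℝ (Fin d)) y =>
          B.indicator (fun _ => (1 : ℝ)) (x, past t y)) :=
        (measurable_const.indicator hB).comp
          (measurable_fst.prodMk ((measurable_past t).comp measurable_snd))
      have key := hG.integral_mul_isOne (s := t) hf (C := 1)
        (fun x y => by by_cases hz : (x, past t y) ∈ B <;> simp [hz])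
        (fun x y y' h => by simp only [dependsOn_past t h])
      rw [integral_map hZ.aemeasurable
          (by exact (hf.mul ((measurable_isOne t).comp measurable_snd)).aestronglyMeasurable),
        integral_map hZ.aemeasurable (by exact (hf.mul (hres t)).aestronglyMeasurable)] at key
      rw [← integral_indicator hs', ← integral_indicator hs']
      have e : ∀ u : Ω → ℝ, (pastPaths X Y t ⁻¹' B).indicator u
          = fun ω => B.indicator (fun _ => (1 : ℝ)) ((paths X Y ω).1,
            past t (paths X Y ω).2) * u ω := by
        intro u
        funext ω
        by_cases hz : pastPaths X Y t ω ∈ B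
        · rw [Set.indicator_of_mem (by exact hz), Set.indicator_of_mem (by exact hz)]
          simp
        · rw [Set.indicator_of_notMem (by exact hz), Set.indicator_of_notMem (by exact hz)]
          simp
      rw [e, e]
      exact key.symm
    · exact (measurable_comp_paths (X := X) (Y := Y)
        (f := fun x y => response F g α γ x t y) (hres t)
        (fun x => (hM.isSpecification α γ).dependsOn x t)).stronglyMeasurable.aestronglyMeasurable
  · filter_upwards [hT] with ω hω
    exact hω.latent_eq hM.rate_pos.le hM.rate_lt_one hM.contraction _ t

lemma isGibbs_of_integral_eq (hM : IsModel F g κ) (hX : ∀ t, Measurable (X t))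
    (hY : ∀ t, Measurable (Y t))
    (h : ∀ (s : ℤ) (f : (ℤ → EuclideanSpace ℝ (Fin d)) → (ℤ → Fin 2) → ℝ),
      Measurable (Function.uncurry f) → (∃ C, ∀ x y, |f x y| ≤ C) →
      (∀ x, DependsOn (f x) (Set.Iio s)) →
      ∫ ω, f (paths X Y ω).1 (paths X Y ω).2 * isOne s (paths X Y ω).2 ∂P
        = ∫ ω, f (paths X Y ω).1 (paths X Y ω).2
            * response F g α γ (paths X Y ω).1 s (paths X Y ω).2 ∂P) :
    IsGibbs (response F g α γ) (P.map (paths X Y)) := by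
  have hZ := measurable_paths hX hY
  have hp := hM.isSpecification α γ
  have := Measure.isProbabilityMeasure_map (μ := P) hZ.aemeasurable
  refine IsGibbs.of_integral_mul_isOne hp fun s f hf hb hd => ?_
  rw [integral_map hZ.aemeasurable
      (by exact (hf.mul ((measurable_isOne s).comp measurable_snd)).aestronglyMeasurable),
    integral_map hZ.aemeasurable (by exact (hf.mul (hp.measurable s)).aestronglyMeasurable)]
  exact h s f hf hb hd

/-- Truncation at `1` gives domination, so no moment of `μ` is needed. -/
lemma tendsto_integral_min_pow_mul (μ : Measure ℝ) [IsProbabilityMeasure μ] (hκ₀ : 0 ≤ κ)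
    (hκ₁ : κ < 1) : Tendsto (fun n : ℕ => ∫ z, min 1 (κ ^ n * |z|) ∂μ) atTop (𝓝 0) := by
  have : Tendsto (fun n : ℕ => ∫ z, min 1 (κ ^ n * |z|) ∂μ) atTop (𝓝 (∫ _ : ℝ, (0 : ℝ) ∂μ)) := by
    refine tendsto_integral_of_dominated_convergence (fun _ => 1) (fun n => ?_)
      (integrable_const _) (fun n => .of_forall fun z => ?_) (.of_forall fun z => ?_)
    · exact (continuous_const.min (continuous_const.mul continuous_abs)).aestronglyMeasurable
    · rw [Real.norm_eq_abs, abs_of_nonneg (by positivity)]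
      exact min_le_left _ _
    · have h1 : Tendsto (fun n : ℕ => κ ^ n * |z|) atTop (𝓝 0) := by
        simpa using (tendsto_pow_atTop_nhds_zero_of_lt_one hκ₀ hκ₁).mul_const |z|
      simpa using (tendsto_const_nhds (x := (1 : ℝ))).min h1
  simpa using this

lemma integrable_min_one {u : Ω → ℝ} (hu : Measurable u) (h0 : ∀ ω, 0 ≤ u ω) :
    Integrable (fun ω => min 1 (u ω)) P :=
  Integrable.of_bound (measurable_const.min hu).aestronglyMeasurable 1 (.of_forall fun ω => by
    rw [Real.norm_eq_abs, abs_of_nonneg (le_min zero_le_one (h0 ω))]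
    exact min_le_left _ _)

/-- A stationary latent process is started from the remote past. -/
lemma IsSolution.lam_eq_latent (h : IsSolution F g α γ P X Y lam) (hM : IsModel F g κ)
    (hT : ∀ᵐ ω ∂P, IsTame κ (input γ fun t => X t ω))
    (hinv : MeasurePreserving shift (pathLaw X P) (pathLaw X P)) (hlam : IsStationary lam P)
    (t : ℤ) :
    ∀ᵐ ω ∂P, lam t ω = latent g α (input γ (paths X Y ω).1) t (paths X Y ω).2 := by
  have hZ := measurable_paths h.measurable_X h.measurable_Y
  have hXm : Measurable fun ω t => X t ω := measurable_pi_lambda _ h.measurable_X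
  have hlm : Measurable fun ω t => lam t ω := measurable_pi_lambda _ h.measurable_lam
  set b := |g 0| + |α|
  let D : ℤ → Ω → ℝ := fun s ω => discounted κ b (input γ fun t => X t ω) s
  let Δ : Ω → ℝ := fun ω =>
    |lam t ω - latent g α (input γ (paths X Y ω).1) t (paths X Y ω).2|
  have hDm : ∀ s, Measurable (D s) := fun s =>
    ((measurable_discounted κ b s).comp (measurable_input γ)).comp hXm
  have hΔm : Measurable Δ :=
    ((h.measurable_lam t).sub ((hM.measurable_latent_input α γ t).comp hZ)).abs
  have hκ0 := hM.rate_pos.le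
  have lawL : ∀ s, P.map (lam s) = P.map (lam 0) := by
    intro s
    have := map_eq_of_invariant hlam.invariant (m := fun x => x) measurable_pi_apply
      (fun _ _ => rfl) s
    simp only [pathLaw] at this
    rwa [Measure.map_map (measurable_pi_apply _) hlm,
      Measure.map_map (measurable_pi_apply _) hlm] at this
  have lawD : ∀ s, P.map (D s) = P.map (D 0) := by
    intro s
    have hmD : ∀ s, Measurable fun x : ℤ → EuclideanSpace ℝ (Fin d) =>
        discounted κ b (input γ x) s := fun s =>
      (measurable_discounted κ b s).comp (measurable_input γ)
    have := map_eq_of_invariant hinv (m := fun x => discounted κ b (input γ x)) hmD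
      (fun x t => discounted_shift κ b (input γ x) t) s
    simp only [pathLaw] at this
    rwa [Measure.map_map (hmD _) hXm, Measure.map_map (hmD _) hXm] at this
  have push : ∀ (u : Ω → ℝ), Measurable u → ∀ n : ℕ,
      ∫ ω, min 1 (κ ^ n * |u ω|) ∂P = ∫ z, min 1 (κ ^ n * |z|) ∂(P.map u) := fun u hu n =>
    (integral_map hu.aemeasurable
      (continuous_const.min (continuous_const.mul continuous_abs)).aestronglyMeasurable).symm
  -- Contraction from time `t - n` bounds `Δ` by `κ ^ n` times the sizes of both latent processes
  -- there. Stationarity makes the laws of `lam (t - n)` and `D (t - n)` independent of `n`, so the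
  -- right side tends to zero.
  have hle : ∀ n : ℕ, ∫ ω, min 1 (Δ ω) ∂P
      ≤ ∫ z, min 1 (κ ^ n * |z|) ∂(P.map (lam 0)) + ∫ z, min 1 (κ ^ n * |z|) ∂(P.map (D 0)) := by
    intro n
    rw [← lawL (t - n), ← lawD (t - n), ← push _ (h.measurable_lam _), ← push _ (hDm _),
      ← integral_add]
    · refine integral_mono_ae (integrable_min_one hΔm fun ω => abs_nonneg _)
        ((integrable_min_one ((h.measurable_lam _).abs.const_mul _)
            fun ω => by positivity).add
          (integrable_min_one ((hDm _).abs.const_mul _) fun ω => by positivity)) ?_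
      filter_upwards [h.ae_abs_sub_latent_le hM hT, hT] with ω hω hωT
      have h1 := hω (t - n) n
      rw [sub_add_cancel] at h1
      have h2 := hωT.abs_latent_le (α := α) hκ0 hM.rate_lt_one hM.contraction
        (paths X Y ω).2 (t - n)
      have h3 := abs_sub (lam (t - n) ω)
        (latent g α (input γ (paths X Y ω).1) (t - n) (paths X Y ω).2)
      have h4 : Δ ω ≤ κ ^ n * |lam (t - n) ω| + κ ^ n * |D (t - n) ω| := by
        refine h1.trans ?_
        rw [← mul_add]
        refine mul_le_mul_of_nonneg_left ?_ (by positivity)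
        have h5 : |latent g α (input γ (paths X Y ω).1) (t - n) (paths X Y ω).2|
          ≤ D (t - n) ω := h2
        have := le_abs_self (D (t - n) ω)
        linarith
      have p1 : 0 ≤ κ ^ n * |lam (t - n) ω| := by positivity
      have p2 : 0 ≤ κ ^ n * |D (t - n) ω| := by positivity
      rcases le_total 1 (κ ^ n * |lam (t - n) ω|) with q1 | q1
      · rw [min_eq_left q1]
        have := min_le_left 1 (Δ ω)
        have := le_min zero_le_one p2
        linarith
      · rcases le_total 1 (κ ^ n * |D (t - n) ω|) with q2 | q2
        · rw [min_eq_left q2]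
          have := min_le_left 1 (Δ ω)
          have := le_min zero_le_one p1
          linarith
        · rw [min_eq_right q1, min_eq_right q2]
          exact (min_le_right _ _).trans h4
    · exact integrable_min_one ((h.measurable_lam _).abs.const_mul _) fun ω => by positivity
    · exact integrable_min_one ((hDm _).abs.const_mul _) fun ω => by positivity
  have := Measure.isProbabilityMeasure_map (μ := P) (h.measurable_lam 0).aemeasurable
  have := Measure.isProbabilityMeasure_map (μ := P) (hDm 0).aemeasurable
  have hzero : ∫ ω, min 1 (Δ ω) ∂P ≤ 0 := by
    have hlim := (tendsto_integral_min_pow_mul (P.map (lam 0)) hκ0 hM.rate_lt_one).add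
      (tendsto_integral_min_pow_mul (P.map (D 0)) hκ0 hM.rate_lt_one)
    rw [add_zero] at hlim
    exact ge_of_tendsto' hlim hle
  have hnn : ∀ ω, 0 ≤ min 1 (Δ ω) := fun ω => le_min zero_le_one (abs_nonneg _)
  have hae := (integral_eq_zero_iff_of_nonneg hnn
    (integrable_min_one hΔm fun ω => abs_nonneg _)).1 (le_antisymm hzero (integral_nonneg hnn))
  filter_upwards [hae] with ω hω
  simp only [Pi.zero_apply] at hω
  have hΔ0 : Δ ω = 0 := by
    rcases min_choice 1 (Δ ω) with q | q
    · rw [q] at hω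
      exact absurd hω one_ne_zero
    · rwa [q] at hω
  exact sub_eq_zero.1 (abs_eq_zero.1 hΔ0)

/-- The law of a solution with a stationary latent process has the prescribed conditional
probabilities. -/
lemma IsSolution.isGibbs_of_isStationary_lam (h : IsSolution F g α γ P X Y lam)
    (hM : IsModel F g κ) (hT : ∀ᵐ ω ∂P, IsTame κ (input γ fun t => X t ω))
    (hinv : MeasurePreserving shift (pathLaw X P) (pathLaw X P)) (hlam : IsStationary lam P) :
    IsGibbs (response F g α γ) (P.map (paths X Y)) := by
  refine isGibbs_of_integral_eq hM h.measurable_X h.measurable_Y ?_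
  rintro s f hf ⟨b, hb⟩ hd
  rw [h.integral_mul_isOne s hf hb hd]
  refine integral_congr_ae ?_
  filter_upwards [h.lam_eq_latent hM hT hinv hlam s] with ω hω
  rw [response, ← hω]

/-- The law of a solution whose covariates and responses are jointly stationary has the prescribed
conditional probabilities. -/
lemma IsSolution.isGibbs_of_measurePreserving (h : IsSolution F g α γ P X Y lam)
    (hM : IsModel F g κ) (hT : ∀ᵐ ω ∂P, IsTame κ (input γ fun t => X t ω))
    (hinv : MeasurePreserving (Prod.map shift shift) (P.map (paths X Y)) (P.map (paths X Y))) :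
    IsGibbs (response F g α γ) (P.map (paths X Y)) := by
  have hp := hM.isSpecification α γ
  have hZ := measurable_paths h.measurable_X h.measurable_Y
  obtain ⟨K, hK⟩ := hM.lipschitz
  set ρ := P.map (paths X Y) with hρ
  have : IsProbabilityMeasure ρ := Measure.isProbabilityMeasure_map hZ.aemeasurable
  refine IsGibbs.of_integral_mul_isOne hp ?_
  rintro s f hf ⟨b, hb⟩ hd
  have b0 : 0 ≤ b := (abs_nonneg _).trans (hb 0 0)
  -- Stationarity of the pair moves the test function to time `s + n` without changing either side
  -- of the identity.
  have shifted : ∀ n : ℕ, ∃ u : (ℤ → EuclideanSpace ℝ (Fin d)) → (ℤ → Fin 2) → ℝ,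
      Measurable (Function.uncurry u) ∧ (∀ x y, |u x y| ≤ b) ∧
      (∀ x, DependsOn (u x) (Set.Iio (s + n))) ∧
      ∫ z, u z.1 z.2 * isOne (s + n) z.2 ∂ρ = ∫ z, f z.1 z.2 * isOne s z.2 ∂ρ ∧
      ∫ z, u z.1 z.2 * response F g α γ z.1 (s + n) z.2 ∂ρ
        = ∫ z, f z.1 z.2 * response F g α γ z.1 s z.2 ∂ρ := by
    intro n
    induction n with
    | zero => exact ⟨f, hf, hb, by simpa using hd, by simp, by simp⟩
    | succ n ih =>
      obtain ⟨u, hu, hub, hud, h1, h2⟩ := ih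
      have e : s + ((n + 1 : ℕ) : ℤ) = s + n + 1 := by push_cast; ring
      rw [e]
      refine ⟨fun x y => u (shift x) (shift y), hu.comp hinv.measurable, fun x y => hub _ _,
        fun x y y' hy => hud _ fun i hi => hy (i + 1) ?_, ?_, ?_⟩
      · have := Set.mem_Iio.1 hi
        exact Set.mem_Iio.2 (by omega)
      · rw [← h1]
        conv_rhs => rw [← hinv.map_eq]
        exact (integral_map (f := fun z => u z.1 z.2 * isOne (s + n) z.2)
          hinv.measurable.aemeasurable
          (by exact (hu.mul ((measurable_isOne _).comp
            measurable_snd)).aestronglyMeasurable)).symm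
      · rw [← h2]
        conv_rhs => rw [← hinv.map_eq]
        rw [integral_map hinv.measurable.aemeasurable
          (by exact (hu.mul (hp.measurable _)).aestronglyMeasurable)]
        refine integral_congr_ae (.of_forall fun z => ?_)
        simp only [Prod.map_fst, Prod.map_snd]
        rw [isEquivariant_response z.1 (s + n) z.2]
  -- The error made by replacing `lam` with `latent` at time `s + n`. It tends to zero almost surely
  -- by contraction from time `s`, and it is bounded by `1`.
  let δ : ℕ → Ω → ℝ := fun n ω =>
    |F (lam (s + n) ω) - response F g α γ (paths X Y ω).1 (s + n) (paths X Y ω).2|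
  have hFl : ∀ r, Measurable fun ω => F (lam r ω) := fun r =>
    hM.continuous_link.measurable.comp (h.measurable_lam r)
  have hδm : ∀ n, Measurable (δ n) := fun n =>
    ((hFl _).sub ((hp.measurable (s + n)).comp hZ)).abs
  have hδ1 : ∀ n ω, ‖δ n ω‖ ≤ 1 := by
    intro n ω
    have h1 := hM.mem_Icc (lam (s + n) ω)
    have h2 := hp.mem_Icc (paths X Y ω).1 (s + n) (paths X Y ω).2
    rw [Real.norm_eq_abs, abs_abs, abs_le]
    constructor <;> linarith [h1.1, h1.2, h2.1, h2.2]
  have hδ0 : Tendsto (fun n => ∫ ω, δ n ω ∂P) atTop (𝓝 (∫ _ : Ω, (0 : ℝ) ∂P)) := by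
    refine tendsto_integral_of_dominated_convergence (fun _ => 1)
      (fun n => (hδm n).aestronglyMeasurable) (integrable_const _)
      (fun n => .of_forall (hδ1 n)) ?_
    filter_upwards [h.ae_abs_sub_latent_le hM hT] with ω hω
    set c := |lam s ω - latent g α (input γ (paths X Y ω).1) s (paths X Y ω).2|
    refine squeeze_zero (g := fun n : ℕ => K * (κ ^ n * c)) (fun n => abs_nonneg _)
      (fun n => ?_) ?_
    · have h2 := hK.dist_le_mul (lam (s + n) ω)
        (latent g α (input γ (paths X Y ω).1) (s + n) (paths X Y ω).2)
      rw [Real.dist_eq, Real.dist_eq] at h2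
      exact h2.trans (mul_le_mul_of_nonneg_left (hω s n) K.2)
    · simpa using ((tendsto_pow_atTop_nhds_zero_of_lt_one hM.rate_pos.le
        hM.rate_lt_one).mul_const c).const_mul (K : ℝ)
  -- The left side does not depend on `n`: it is the defect of the Gibbs identity at time `s`,
  -- computed at time `s + n`.
  have bound : ∀ n, |∫ z, f z.1 z.2 * isOne s z.2 ∂ρ
      - ∫ z, f z.1 z.2 * response F g α γ z.1 s z.2 ∂ρ| ≤ b * ∫ ω, δ n ω ∂P := by
    intro n
    obtain ⟨u, hu, hub, hud, h1, h2⟩ := shifted n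
    have hum : Measurable fun ω => u (paths X Y ω).1 (paths X Y ω).2 := hu.comp hZ
    have hi : ∀ v : Ω → ℝ, Measurable v → (∀ ω, v ω ∈ Set.Icc (0 : ℝ) 1) →
        Integrable (fun ω => u (paths X Y ω).1 (paths X Y ω).2 * v ω) P := by
      intro v hv hv1
      refine Integrable.of_bound (hum.mul hv).aestronglyMeasurable b (.of_forall fun ω => ?_)
      rw [Real.norm_eq_abs, abs_mul, abs_of_nonneg (hv1 ω).1]
      nlinarith [hub (paths X Y ω).1 (paths X Y ω).2, (hv1 ω).1, (hv1 ω).2,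
        abs_nonneg (u (paths X Y ω).1 (paths X Y ω).2)]
    rw [← h1, ← h2, hρ, integral_map hZ.aemeasurable
        (by exact (hu.mul ((measurable_isOne _).comp measurable_snd)).aestronglyMeasurable),
      integral_map hZ.aemeasurable (by exact (hu.mul (hp.measurable _)).aestronglyMeasurable),
      h.integral_mul_isOne (s + n) hu hub hud,
      ← integral_sub (hi _ (hFl _) fun ω => hM.mem_Icc _)
        (hi (fun ω => response F g α γ (paths X Y ω).1 (s + n) (paths X Y ω).2)
          ((hp.measurable (s + n)).comp hZ) fun ω => hp.mem_Icc _ _ _),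
      ← integral_const_mul, ← Real.norm_eq_abs]
    refine norm_integral_le_of_norm_le ((Integrable.of_bound (hδm n).aestronglyMeasurable 1
      (.of_forall (hδ1 n))).const_mul b) (.of_forall fun ω => ?_)
    rw [← mul_sub, Real.norm_eq_abs, abs_mul]
    exact mul_le_mul_of_nonneg_right (hub _ _) (abs_nonneg _)
  rw [integral_zero] at hδ0
  have hlim := hδ0.const_mul b
  rw [mul_zero] at hlim
  exact sub_eq_zero.1 (abs_nonpos_iff.1 (ge_of_tendsto' hlim bound))

end Solution

end BinaryAR

/-! ### Path space and proof of the theorem -/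

namespace BinaryAR

/-- The kernel sees `ω` only through `u ω`. This links the enlargement of the given probability
space with the law built on path space. -/
lemma map_compProd_comap {Ω S T : Type*} [MeasurableSpace Ω] [MeasurableSpace S]
    [MeasurableSpace T] {P : Measure Ω} [IsProbabilityMeasure P] {u : Ω → S} (hu : Measurable u)
    (η : Kernel S T) [IsMarkovKernel η] :
    (P ⊗ₘ η.comap u hu).map (Prod.map u id) = P.map u ⊗ₘ η := by
  have := Measure.isProbabilityMeasure_map (μ := P) hu.aemeasurable
  have hm : Measurable (Prod.map u (id : T → T)) := hu.prodMap measurable_id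
  ext B hB
  rw [Measure.map_apply hm hB, Measure.compProd_apply (hm hB), Measure.compProd_apply hB,
    lintegral_map (Kernel.measurable_kernel_prodMk_left hB) hu]
  rfl

section PathSpace

variable {S : Type*} [MeasurableSpace S]

/-- The trajectory of a pair of processes. -/
def zipPaths (z : (ℤ → S) × (ℤ → Fin 2)) : ℤ → S × Fin 2 := fun t => (z.1 t, z.2 t)

lemma measurable_zipPaths : Measurable (zipPaths (S := S)) :=
  measurable_pi_lambda _ fun t => ((measurable_pi_apply t).comp measurable_fst).prodMk
    ((measurable_pi_apply t).comp measurable_snd)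

lemma pathLaw_eq_map_zipPaths {Ω : Type*} [MeasurableSpace Ω] {P : Measure Ω}
    {X : ℤ → Ω → S} {Y : ℤ → Ω → Fin 2} (hX : ∀ t, Measurable (X t))
    (hY : ∀ t, Measurable (Y t)) :
    pathLaw (fun t ω => (X t ω, Y t ω)) P = (P.map (paths X Y)).map zipPaths := by
  rw [Measure.map_map measurable_zipPaths (measurable_paths hX hY)]
  rfl

lemma measurePreserving_paths_of_isStationary {Ω : Type*} [MeasurableSpace Ω] {P : Measure Ω}
    {X : ℤ → Ω → S} {Y : ℤ → Ω → Fin 2} (hX : ∀ t, Measurable (X t))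
    (hY : ∀ t, Measurable (Y t)) (h : IsStationary (fun t ω => (X t ω, Y t ω)) P) :
    MeasurePreserving (Prod.map shift shift) (P.map (paths X Y)) (P.map (paths X Y)) := by
  let unzip : (ℤ → S × Fin 2) → (ℤ → S) × (ℤ → Fin 2) :=
    fun x => (fun t => (x t).1, fun t => (x t).2)
  have hu : Measurable unzip :=
    (measurable_pi_lambda _ fun t => measurable_fst.comp (measurable_pi_apply t)).prodMk
      (measurable_pi_lambda _ fun t => measurable_snd.comp (measurable_pi_apply t))
  have hp : MeasurePreserving unzip (pathLaw (fun t ω => (X t ω, Y t ω)) P)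
      (P.map (paths X Y)) := by
    refine ⟨hu, ?_⟩
    rw [pathLaw, Measure.map_map hu (measurable_pi_lambda _ fun t => (hX t).prodMk (hY t))]
    rfl
  exact hp.of_semiconj h.invariant (fun _ => rfl) (measurable_prodMap_shift measurable_shift)

end PathSpace

end BinaryAR

theorem proposition3 {d : ℕ} {Ω : Type*} [MeasurableSpace Ω]
    (P : Measure Ω) [IsProbabilityMeasure P]
    (F g : ℝ → ℝ) (α : ℝ) (γ : EuclideanSpace ℝ (Fin d))
    (X : ℤ → Ω → EuclideanSpace ℝ (Fin d))
    (hF : BinaryAR.IsCDF F) (hFpos : ∀ s, 0 < F s) (hFlip : ∃ K, LipschitzWith K F)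
    (κ : ℝ) (hκ₀ : 0 < κ) (hκ₁ : κ < 1) (hg : ∀ s s' : ℝ, |g s - g s'| ≤ κ * |s - s'|)
    (hX : BinaryAR.IsStationaryErgodic X P)
    (hXlog : Integrable (fun ω => Real.posLog ‖X 0 ω‖) P) :
    -- existence, on an enlargement of the probability space that carries the covariates
    ∃ (Q : Measure ((ℤ → Fin 2) × Ω)) (lam : ℤ → (ℤ → Fin 2) × Ω → ℝ),
      IsProbabilityMeasure Q ∧
      Q.map Prod.snd = P ∧
      BinaryAR.IsSolution F g α γ Q (fun t p => X t p.2) (fun t p => p.1 t) lam ∧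
      BinaryAR.IsStationary (fun t p => (X t p.2, p.1 t, lam t p)) Q ∧
      BinaryAR.IsStationaryErgodic (fun t p => (X t p.2, p.1 t)) Q ∧
      -- uniqueness in law of the pair, for a given law of the covariates
      ∀ {Ω' : Type*} [MeasurableSpace Ω'] (P' : Measure Ω') [IsProbabilityMeasure P']
        (X' : ℤ → Ω' → EuclideanSpace ℝ (Fin d)) (Y' : ℤ → Ω' → Fin 2) (lam' : ℤ → Ω' → ℝ),
        BinaryAR.pathLaw X' P' = BinaryAR.pathLaw X P →
        BinaryAR.IsSolution F g α γ P' X' Y' lam' →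
        (BinaryAR.IsStationary (fun t ω => (X' t ω, Y' t ω)) P' ∨
          BinaryAR.IsStationary lam' P') →
        BinaryAR.pathLaw (fun t ω => (X' t ω, Y' t ω)) P' =
          BinaryAR.pathLaw (fun t p => (X t p.2, p.1 t)) Q := by
  open BinaryAR in
  have hM : IsModel F g κ := by
    obtain ⟨ν, _, hν⟩ := hF
    have e : F = cdf ν := funext hν
    exact ⟨e ▸ monotone_cdf ν, hFpos, fun s => hν s ▸ cdf_le_one ν s, hFlip, hκ₀, hκ₁, hg⟩
  set ν := pathLaw X P with hνdef
  have hXp : Measurable fun ω t => X t ω := measurable_pi_lambda _ hX.measurable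
  have : IsProbabilityMeasure ν := Measure.isProbabilityMeasure_map hXp.aemeasurable
  have hν := hX.ergodic.toMeasurePreserving
  have hlog : Integrable (fun x : ℤ → EuclideanSpace ℝ (Fin d) => Real.posLog ‖x 0‖) ν := by
    refine (integrable_map_measure ?_ hXp.aemeasurable).2 hXlog
    exact ((Real.continuous_posLog.comp continuous_norm).measurable.comp
      (measurable_pi_apply 0)).aestronglyMeasurable
  have hT := hM.ae_isTame γ hν hlog
  have hforget := hM.ae_forgets α γ hν hlog
  have hp := hM.isSpecification α γ
  obtain ⟨η, hη, hG⟩ := exists_kernel_isGibbs hp ν (by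
    filter_upwards [hT] with x hx s
    exact hM.continuous_link.comp (hx.continuous_latent hκ₀.le hκ₁ hg s)) hforget
  set ρ := ν ⊗ₘ η with hρ
  have hfst : ρ.map Prod.fst = ν := Measure.fst_compProd ν η
  -- Given `ω`, the responses are drawn from the kernel at the covariate trajectory of `ω`;
  -- `Prod.swap` below only restores the order of the factors.
  let Q₀ : Measure (Ω × (ℤ → Fin 2)) := P ⊗ₘ η.comap (fun ω t => X t ω) hXp
  let Q : Measure ((ℤ → Fin 2) × Ω) := Q₀.map Prod.swap
  have hQ : IsProbabilityMeasure Q :=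
    Measure.isProbabilityMeasure_map measurable_swap.aemeasurable
  have hQP : Q.map Prod.snd = P := by
    rw [Measure.map_map measurable_snd measurable_swap]
    exact Measure.fst_compProd P _
  have hXm : ∀ t, Measurable fun p : (ℤ → Fin 2) × Ω => X t p.2 := fun t =>
    (hX.measurable t).comp measurable_snd
  have hYm : ∀ t, Measurable fun p : (ℤ → Fin 2) × Ω => p.1 t := fun t =>
    (measurable_pi_apply t).comp measurable_fst
  have hQρ : Q.map (paths (fun t p => X t p.2) (fun t p => p.1 t)) = ρ := by
    rw [Measure.map_map (measurable_paths hXm hYm) measurable_swap]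
    exact map_compProd_comap hXp η
  have herg : Ergodic (Prod.map shift shift) ρ :=
    hG.ergodic hp isEquivariant_response (by rwa [hfst]) (by rw [hfst]; exact hX.ergodic)
  have hTQ : ∀ᵐ p ∂Q, IsTame κ (input γ fun t => X t p.2) := by
    have h1 : ∀ᵐ ω ∂P, IsTame κ (input γ fun t => X t ω) := ae_of_ae_map hXp.aemeasurable hT
    rw [← hQP] at h1
    exact ae_of_ae_map measurable_snd.aemeasurable h1
  have hlatm := fun t => hM.measurable_latent_input α γ t
  refine ⟨Q, _, hQ, hQP, isSolution_of_isGibbs hM hXm hYm (by rwa [hQρ]) hTQ, ?_, ?_, ?_⟩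
  -- The triple is a function of the pair of trajectories that commutes with the shifts, so it
  -- inherits invariance.
  · let Φ : (ℤ → EuclideanSpace ℝ (Fin d)) × (ℤ → Fin 2) →
        ℤ → EuclideanSpace ℝ (Fin d) × Fin 2 × ℝ :=
      fun z t => (z.1 t, z.2 t, latent g α (input γ z.1) t z.2)
    have hΦ : Measurable Φ := measurable_pi_lambda _ fun t =>
      ((measurable_pi_apply t).comp measurable_fst).prodMk
        (((measurable_pi_apply t).comp measurable_snd).prodMk (hlatm t))
    have hZ := measurable_paths hXm hYm
    refine ⟨fun t => (hXm t).prodMk ((hYm t).prodMk ((hlatm t).comp hZ)), ?_⟩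
    have hmp : MeasurePreserving Φ ρ (pathLaw (fun t p => (X t p.2, p.1 t,
        latent g α (input γ (paths (fun t p => X t p.2) (fun t p => p.1 t) p).1) t
          (paths (fun t p => X t p.2) (fun t p => p.1 t) p).2)) Q) := by
      refine ⟨hΦ, ?_⟩
      rw [← hQρ, Measure.map_map hΦ hZ]
      rfl
    refine hmp.of_semiconj herg.toMeasurePreserving (fun z => ?_) measurable_shift
    funext t
    change (_, _, latent g α (shift (input γ z.1)) t (shift z.2)) = _
    rw [latent_shift]
    rfl
  · refine ⟨fun t => (hXm t).prodMk (hYm t), ?_⟩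
    have hmp : MeasurePreserving zipPaths ρ
        (pathLaw (fun t (p : (ℤ → Fin 2) × Ω) => (X t p.2, p.1 t)) Q) := by
      refine ⟨measurable_zipPaths, ?_⟩
      rw [pathLaw_eq_map_zipPaths hXm hYm, hQρ]
    -- A factor of an ergodic system is ergodic.
    exact hmp.ergodic_of_ergodic_semiconj herg measurable_shift fun _ => rfl
  · intro Ω' _ P' _ X' Y' lam' hlaw hsol hst
    have hX'p : Measurable fun ω t => X' t ω := measurable_pi_lambda _ hsol.measurable_X
    -- Tameness is a property of the covariate trajectory alone, hence determined by its law.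
    have hT' : ∀ᵐ ω ∂P', IsTame κ (input γ fun t => X' t ω) := by
      have h1 : ∀ᵐ x ∂pathLaw X' P', IsTame κ (input γ x) := by rwa [hlaw]
      exact ae_of_ae_map hX'p.aemeasurable h1
    have hG' : IsGibbs (response F g α γ) (P'.map (paths X' Y')) := by
      rcases hst with hst | hst
      · exact hsol.isGibbs_of_measurePreserving hM hT'
          (measurePreserving_paths_of_isStationary hsol.measurable_X hsol.measurable_Y hst)
      · exact hsol.isGibbs_of_isStationary_lam hM hT' (by rw [hlaw]; exact hν) hst
    have hfst' : (P'.map (paths X' Y')).map Prod.fst = ρ.map Prod.fst := by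
      rw [hfst, ← hlaw, Measure.map_map measurable_fst
        (measurable_paths hsol.measurable_X hsol.measurable_Y)]
      rfl
    have heq := hG.eq_of_map_fst_eq hp hG' (by rwa [hfst]) hfst'
    rw [pathLaw_eq_map_zipPaths hsol.measurable_X hsol.measurable_Y,
      pathLaw_eq_map_zipPaths hXm hYm, heq, hQρ]
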